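/- **Theorem 2.1.** Let $Z,\lambda_1,\lambda_2\in\mathbb R$. Consider, for complex-valued functions on $\mathbb R$, the cubic–quintic NLS with $\delta$-interaction $$ iu_t-A_Zu+(\lambda_1|u|^2+\lambda_2|u|^4)u=0,\qquad A_Z=-\frac{d^2}{dx^2}-Z\delta(x). $$ Here $A_Z$ is the self-adjoint operator in $L^2(\mathbb R)$ with domain $\{g\in H^1(\mathbb R)\cap H^2(\mathbb R\setminus\{0\}) : g'(0+)-g'(0-)=-Zg(0)\}$ and $A_Zg=-g''$ for $x\ne0$. It extends to the bounded operator $H^1(\mathbb R)\to H^{-1}(\mathbb R)$, $A_Zu=-u''-Zu(0)\delta$. For $T>0$, a solution on $[-T,T]$ with datum $u_0\in H^1(\mathbb R)$ means a function $u\in C([-T,T];H^1(\mathbb R))\cap C^1([-T,T];H^{-1}(\mathbb R))$ that satisfies the equation in $H^{-1}(\mathbb R)$ for every $t\in[-T,T]$ and has $u(0)=u_0$. Then: 1. For every $u_0\in H^1(\mathbb R)$ there is $T>0$ such that there exists a unique solution on $[-T,T]$ with datum $u_0$. Moreover, for every $T>0$, two solutions on $[-T,T]$ with the same datum coincide. 2.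 For every $T>0$, the set $D_T\subset H^1(\mathbb R)$ of those data $u_0$ that admit a solution on $[-T,T]$ is open, and the data-to-solution map $D_T\ni u_0\mapsto u\in C([-T,T];H^1(\mathbb R))$ is smooth (that is, $C^\infty$ in the Fréchet sense between these spaces regarded as real Banach spaces). 3. For every $T>0$, if $u$ is a solution on $[-T,T]$ with datum $u_0$ and $u_0$ is even, then $u(t)$ is even for every $t\in[-T,T]$. -/

import Mathlib

open MeasureTheory Set
open scoped ContDiff ENNReal

namespace NLSDelta

/-- The Hilbert space `L²(ℝ)` of complex-valued functions. -/
abbrev L2 : Type := Lp ℂ 2 (volume : Measure ℝ)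

/-- `g` is the weak derivative of `f`. -/
def HasWeakDeriv (f g : L2) : Prop :=
  ∀ φ : ℝ → ℝ, ContDiff ℝ ∞ φ → HasCompactSupport φ →
    ∫ x, deriv φ x • f x = -∫ x, φ x • g x

theorem L2.locallyIntegrable (f : L2) : LocallyIntegrable f volume :=
  (Lp.memLp f).locallyIntegrable one_le_two

theorem L2.integrable_smul (f : L2) {φ : ℝ → ℝ} (hφ : Continuous φ)
    (hc : HasCompactSupport φ) : Integrable (fun x => φ x • f x) :=
  f.locallyIntegrable.integrable_smul_left_of_hasCompactSupport hφ hc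

theorem L2.integral_smul_add (f g : L2) {φ : ℝ → ℝ} (hφ : Continuous φ)
    (hc : HasCompactSupport φ) :
    ∫ x, φ x • (f + g : L2) x = (∫ x, φ x • f x) + ∫ x, φ x • g x := by
  rw [← integral_add (f.integrable_smul hφ hc) (g.integrable_smul hφ hc)]
  refine integral_congr_ae ?_
  filter_upwards [Lp.coeFn_add f g] with x hx
  rw [hx, Pi.add_apply, smul_add]

theorem L2.integral_smul_smul (c : ℂ) (f : L2) (φ : ℝ → ℝ) :
    ∫ x, φ x • (c • f : L2) x = c * ∫ x, φ x • f x := by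
  rw [← integral_const_mul]
  refine integral_congr_ae ?_
  filter_upwards [Lp.coeFn_smul c f] with x hx
  rw [hx, Pi.smul_apply, smul_comm, smul_eq_mul c]

/-- The Sobolev space `H¹(ℝ)`, realised as the set of pairs `(u, u')` in `L² × L²` such that `u'`
is the weak derivative of `u`, with norm `(‖u‖² + ‖u'‖²)^(1/2)`. -/
def sobolevSubmodule : Submodule ℂ (WithLp 2 (L2 × L2)) where
  carrier := {p | HasWeakDeriv p.fst p.snd}
  zero_mem' := by
    intro φ _ _
    have h : ((0 : L2) : ℝ → ℂ) =ᵐ[volume] 0 := Lp.coeFn_zero ..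
    have h1 : ∀ ψ : ℝ → ℝ, ∫ x, ψ x • (0 : L2) x = 0 := fun ψ => by
      rw [integral_congr_ae (g := fun _ => (0 : ℂ)), integral_zero]
      filter_upwards [h] with x hx
      rw [hx, Pi.zero_apply, smul_zero]
    rw [WithLp.zero_fst, WithLp.zero_snd, h1, h1, neg_zero]
  add_mem' := by
    intro p q hp hq φ hφ hc
    have hd : Continuous (deriv φ) := hφ.continuous_deriv (by simp)
    rw [WithLp.add_fst, WithLp.add_snd, L2.integral_smul_add _ _ hd hc.deriv,
      L2.integral_smul_add _ _ hφ.continuous hc, hp φ hφ hc, hq φ hφ hc]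
    ring
  smul_mem' := by
    intro c p hp φ hφ hc
    rw [WithLp.smul_fst, WithLp.smul_snd, L2.integral_smul_smul, L2.integral_smul_smul,
      hp φ hφ hc]
    ring

noncomputable section

/-- The Sobolev space `H¹(ℝ)`, with the Hilbert space structure inherited from `L² × L²`. -/
def H1 : Type := sobolevSubmodule

instance : NormedAddCommGroup H1 := inferInstanceAs (NormedAddCommGroup sobolevSubmodule)

instance : InnerProductSpace ℂ H1 := inferInstanceAs (InnerProductSpace ℂ sobolevSubmodule)

/-- The isometric inclusion `u ↦ (u, u')` of `H¹(ℝ)` in `L² × L²`. -/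
def H1.subtypeL : H1 →L[ℂ] WithLp 2 (L2 × L2) := sobolevSubmodule.subtypeL

/-- The inclusion of `H¹(ℝ)` in `L²(ℝ)`. -/
def H1.toL2 : H1 →L[ℂ] L2 := (WithLp.fstL 2 ℂ L2 L2).comp H1.subtypeL

/-- The weak derivative `H¹(ℝ) → L²(ℝ)`. -/
def H1.weakDeriv : H1 →L[ℂ] L2 := (WithLp.sndL 2 ℂ L2 L2).comp H1.subtypeL

theorem H1.hasWeakDeriv (u : H1) : HasWeakDeriv u.toL2 u.weakDeriv := u.2

/-! ### Primitives and continuous representatives -/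

theorem intervalIntegrable_of_locallyIntegrable {g : ℝ → ℂ} (hg : LocallyIntegrable g volume)
    (a b : ℝ) : IntervalIntegrable g volume a b :=
  intervalIntegrable_iff.mpr
    ((hg.integrableOn_isCompact isCompact_uIcc).mono_set uIoc_subset_uIcc)

theorem absolutelyContinuous_const (c : ℂ) (a b : ℝ) :
    AbsolutelyContinuousOnInterval (fun _ => c) a b :=
  (LipschitzOnWith.absolutelyContinuousOnInterval (K := 0)
    (LipschitzWith.const c).lipschitzOnWith)

theorem absolutelyContinuous_primitive {g : ℝ → ℂ} (hg : LocallyIntegrable g volume)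
    {a b c : ℝ} (hc : c ∈ uIcc a b) :
    AbsolutelyContinuousOnInterval (fun x => ∫ t in c..x, g t) a b := by
  have hi : ∀ x y : ℝ, IntervalIntegrable g volume x y := intervalIntegrable_of_locallyIntegrable hg
  have hre : ∀ x y : ℝ, IntervalIntegrable (fun t => (g t).re) volume x y := fun x y =>
    ⟨(hi x y).1.re, (hi x y).2.re⟩
  have him : ∀ x y : ℝ, IntervalIntegrable (fun t => (g t).im) volume x y := fun x y =>
    ⟨(hi x y).1.im, (hi x y).2.im⟩
  have h1 := ((hre a b).absolutelyContinuousOnInterval_intervalIntegral hc).smul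
    (absolutelyContinuous_const 1 a b)
  have h2 := ((him a b).absolutelyContinuousOnInterval_intervalIntegral hc).smul
    (absolutelyContinuous_const Complex.I a b)
  have e : (fun x => ∫ t in c..x, g t) =
      ((fun x => ∫ t in c..x, (g t).re) • fun _ => (1 : ℂ)) +
        ((fun x => ∫ t in c..x, (g t).im) • fun _ => Complex.I) := by
    funext x
    change _ = (∫ v in c..x, (g v).re) • (1 : ℂ) + (∫ v in c..x, (g v).im) • Complex.I
    rw [Complex.real_smul, Complex.real_smul, mul_one,
      ← intervalIntegral.integral_ofReal, ← intervalIntegral.integral_ofReal,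
      ← intervalIntegral.integral_mul_const, ← intervalIntegral.integral_add]
    · simp [Complex.re_add_im]
    · exact ⟨(hre c x).1.ofReal, (hre c x).2.ofReal⟩
    · exact IntervalIntegrable.mul_const ⟨(him c x).1.ofReal, (him c x).2.ofReal⟩ _
  rw [e]
  exact h1.add h2

/-- Integration by parts for primitives of locally integrable functions. -/
theorem integral_by_parts {g h : ℝ → ℂ} (hg : LocallyIntegrable g volume)
    (hh : LocallyIntegrable h volume) (c d : ℂ) (a b : ℝ) :
    ∫ x in a..b, (g x * (d + ∫ t in a..x, h t) + (c + ∫ t in a..x, g t) * h x) =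
      (c + ∫ t in a..b, g t) * (d + ∫ t in a..b, h t) - c * d := by
  have hG : Continuous fun x => c + ∫ t in a..x, g t :=
    continuous_const.add (intervalIntegral.continuous_primitive
      (intervalIntegrable_of_locallyIntegrable hg) a)
  have hH : Continuous fun x => d + ∫ t in a..x, h t :=
    continuous_const.add (intervalIntegral.continuous_primitive
      (intervalIntegrable_of_locallyIntegrable hh) a)
  have hk : LocallyIntegrable
      (fun x => g x * (d + ∫ t in a..x, h t) + (c + ∫ t in a..x, g t) * h x) volume := by
    refine LocallyIntegrable.add ?_ ?_
    · exact (locallyIntegrable_iff.2 fun K hK =>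
        (hg.integrableOn_isCompact hK).mul_continuousOn hH.continuousOn hK)
    · exact (locallyIntegrable_iff.2 fun K hK =>
        (hh.integrableOn_isCompact hK).continuousOn_mul hG.continuousOn hK)
  have ha : a ∈ uIcc a b := left_mem_uIcc
  have hac := (((absolutelyContinuous_const c a b).add
    (absolutelyContinuous_primitive hg ha)).smul ((absolutelyContinuous_const d a b).add
    (absolutelyContinuous_primitive hh ha))).sub (absolutelyContinuous_primitive hk ha)
  obtain ⟨C, hC⟩ := hac.const_of_ae_hasDerivAt_zero (by
    filter_upwards [LocallyIntegrable.ae_hasDerivAt_integral hg, LocallyIntegrable.ae_hasDerivAt_integral hh,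
      LocallyIntegrable.ae_hasDerivAt_integral hk] with x h1 h2 h3 _
    have := (((h1 a).const_add c).mul ((h2 a).const_add d)).sub (h3 a)
    simp only [sub_self] at this
    exact this)
  have e1 := hC a left_mem_uIcc
  have e2 := hC b right_mem_uIcc
  simp at e1 e2
  rw [← e1] at e2
  linear_combination -e2

theorem exists_support_subset_Ioo {φ : ℝ → ℝ} (hc : HasCompactSupport φ) :
    ∃ a b : ℝ, a < b ∧ tsupport φ ⊆ Ioo a b := by
  obtain ⟨R, hR⟩ := hc.isCompact.isBounded.subset_ball (0 : ℝ)
  refine ⟨-(|R| + 1), |R| + 1, by linarith [abs_nonneg R], fun x hx => ?_⟩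
  have h := hR hx
  rw [mem_ball_zero_iff, Real.norm_eq_abs] at h
  have h2 := le_abs_self R
  exact ⟨by linarith [neg_abs_le x], by linarith [le_abs_self x]⟩

/-- A primitive of a locally integrable function has that function as weak derivative. -/
theorem integral_deriv_smul_primitive {g : ℝ → ℂ} (hg : LocallyIntegrable g volume)
    {φ : ℝ → ℝ} (hφ : ContDiff ℝ ∞ φ) (hc : HasCompactSupport φ) :
    ∫ x, deriv φ x • (∫ t in (0 : ℝ)..x, g t) = -∫ x, φ x • g x := by
  obtain ⟨a, b, hab, hs⟩ := exists_support_subset_Ioo hc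
  have hi := intervalIntegrable_of_locallyIntegrable hg
  have hd : Continuous (deriv φ) := hφ.continuous_deriv (by simp)
  have h0 : ∀ x, x ∉ Ioo a b → φ x = 0 := fun x hx =>
    image_eq_zero_of_notMem_tsupport fun h => hx (hs h)
  have ha : φ a = 0 := h0 a (by simp)
  have hb : φ b = 0 := h0 b (by simp)
  have hF : ∀ x, ∫ t in a..x, ((deriv φ t : ℝ) : ℂ) = φ x := fun x => by
    rw [intervalIntegral.integral_ofReal, intervalIntegral.integral_deriv_eq_sub
      (fun y _ => (hφ.differentiable (by simp)) y) (hd.intervalIntegrable _ _), ha, sub_zero]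
  have hG : ∀ x, (∫ t in (0 : ℝ)..a, g t) + ∫ t in a..x, g t = ∫ t in (0 : ℝ)..x, g t :=
    fun x => intervalIntegral.integral_add_adjacent_intervals (hi _ _) (hi _ _)
  have hcont : Continuous fun x => ∫ t in (0 : ℝ)..x, g t :=
    intervalIntegral.continuous_primitive hi 0
  have key := integral_by_parts hg (h := fun t => ((deriv φ t : ℝ) : ℂ))
    (Complex.continuous_ofReal.comp hd).locallyIntegrable (∫ t in (0 : ℝ)..a, g t) 0 a b
  simp only [hF, hG, hb] at key
  rw [intervalIntegral.integral_add] at key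
  · have s1 : Function.support (fun x => g x * (0 + (φ x : ℂ))) ⊆ Ioc a b := by
      intro x hx
      by_contra h
      exact hx (by simp [h0 x fun h' => h (Ioo_subset_Ioc_self h')])
    have s2 : Function.support (fun x => (∫ t in (0 : ℝ)..x, g t) * ((deriv φ x : ℝ) : ℂ)) ⊆
        Ioc a b := by
      intro x hx
      by_contra h
      have : deriv φ x = 0 := image_eq_zero_of_notMem_tsupport fun h' =>
        h (Ioo_subset_Ioc_self (hs (tsupport_deriv_subset h')))
      exact hx (by simp [this])
    rw [intervalIntegral.integral_eq_integral_of_support_subset s1,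
      intervalIntegral.integral_eq_integral_of_support_subset s2] at key
    simp only [Complex.real_smul]
    simp only [zero_add, mul_comm (g _)] at key
    simp only [mul_comm ((deriv φ _ : ℝ) : ℂ)]
    simp at key
    linear_combination key
  · exact (hi a b).mul_continuousOn
      (continuous_const.add (Complex.continuous_ofReal.comp hφ.continuous)).continuousOn
  · exact (hcont.mul (Complex.continuous_ofReal.comp hd)).intervalIntegrable _ _

/-- A locally integrable function with vanishing weak derivative is almost everywhere constant. -/
theorem ae_const_of_weakDeriv_zero {k : ℝ → ℂ} (hk : LocallyIntegrable k volume)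
    (h : ∀ φ : ℝ → ℝ, ContDiff ℝ ∞ φ → HasCompactSupport φ → ∫ x, deriv φ x • k x = 0) :
    ∃ C : ℂ, k =ᵐ[volume] fun _ => C := by
  let B : ContDiffBump (0 : ℝ) := ⟨1, 2, one_pos, one_lt_two⟩
  let θ : ℝ → ℝ := B.normed volume
  have hθ : ContDiff ℝ ∞ θ := B.contDiff_normed
  have hθc : HasCompactSupport θ := B.hasCompactSupport_normed
  have hθ1 : ∫ x, θ x = 1 := B.integral_normed
  refine ⟨∫ x, θ x • k x, ae_eq_of_integral_contDiff_smul_eq hk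
    (locallyIntegrable_const _) fun φ hφ hc => ?_⟩
  set m := ∫ x, φ x
  let η : ℝ → ℝ := fun x => φ x - m * θ x
  have hη : ContDiff ℝ ∞ η := hφ.sub (contDiff_const.mul hθ)
  have hηc : HasCompactSupport η := hc.sub (hθc.mul_left)
  obtain ⟨a, b, hab, hs⟩ := exists_support_subset_Ioo hηc
  have h0 : ∀ x, x ∉ Ioo a b → η x = 0 := fun x hx =>
    image_eq_zero_of_notMem_tsupport fun h => hx (hs h)
  have hηi : ∀ x y, IntervalIntegrable η volume x y :=
    fun x y => hη.continuous.intervalIntegrable _ _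
  have hI : ∫ x in a..b, η x = 0 := by
    rw [intervalIntegral.integral_eq_integral_of_support_subset]
    · rw [integral_sub (hφ.continuous.integrable_of_hasCompactSupport hc)
        ((hθ.continuous.integrable_of_hasCompactSupport hθc).const_mul m),
        integral_const_mul, hθ1]
      simp [m]
    · intro x hx
      by_contra h'
      exact hx (h0 x fun h'' => h' (Ioo_subset_Ioc_self h''))
  let ψ : ℝ → ℝ := fun x => ∫ t in a..x, η t
  have hψ : ∀ x, HasDerivAt ψ (η x) x := fun x =>
    intervalIntegral.integral_hasDerivAt_right (hηi _ _)
      (hη.continuous.stronglyMeasurableAtFilter _ _) hη.continuous.continuousAt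
  have hψ' : deriv ψ = η := funext fun x => (hψ x).deriv
  have hψs : ContDiff ℝ ∞ ψ := contDiff_infty_iff_deriv.2
    ⟨fun x => (hψ x).differentiableAt, hψ' ▸ hη⟩
  have hψc : HasCompactSupport ψ := by
    refine HasCompactSupport.intro (isCompact_Icc (a := a) (b := b)) fun x hx => ?_
    rcases lt_or_ge x a with hxa | hxa
    · change ∫ t in a..x, η t = 0
      refine (intervalIntegral.integral_congr (g := fun _ => (0 : ℝ)) fun t ht => ?_).trans
        (by simp)
      rw [uIcc_of_ge hxa.le] at ht
      exact h0 t fun h' => absurd ht.2 (not_le.2 h'.1)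
    · have hxb : b < x := lt_of_not_ge fun h' => hx ⟨hxa, h'⟩
      change ∫ t in a..x, η t = 0
      rw [← intervalIntegral.integral_add_adjacent_intervals (hηi a b) (hηi b x), hI, zero_add]
      refine (intervalIntegral.integral_congr (g := fun _ => (0 : ℝ)) fun t ht => ?_).trans
        (by simp)
      rw [uIcc_of_le hxb.le] at ht
      exact h0 t fun h' => absurd ht.1 (not_le.2 h'.2)
  have key := h ψ hψs hψc
  rw [hψ'] at key
  have i1 : Integrable fun x => φ x • k x :=
    hk.integrable_smul_left_of_hasCompactSupport hφ.continuous hc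
  have i2 : Integrable fun x => θ x • k x :=
    hk.integrable_smul_left_of_hasCompactSupport hθ.continuous hθc
  have e : ∀ x, η x • k x = φ x • k x - m • (θ x • k x) := fun x => by
    simp only [η, sub_smul, mul_smul]
  simp only [e] at key
  have i3 : Integrable fun x => m • (θ x • k x) := i2.smul m
  rw [integral_sub i1 i3, integral_smul, sub_eq_zero] at key
  rw [key, integral_smul_const]

/-- Every element of `H¹(ℝ)` is almost everywhere equal to a primitive of its weak derivative. -/
theorem H1.exists_primitive (u : H1) :
    ∃ C : ℂ, u.toL2 =ᵐ[volume] fun x => C + ∫ t in (0 : ℝ)..x, u.weakDeriv t := by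
  have hg := u.weakDeriv.locallyIntegrable
  have hf := u.toL2.locallyIntegrable
  have hcont : Continuous fun x => ∫ t in (0 : ℝ)..x, u.weakDeriv t :=
    intervalIntegral.continuous_primitive (intervalIntegrable_of_locallyIntegrable hg) 0
  obtain ⟨C, hC⟩ := ae_const_of_weakDeriv_zero (hf.sub hcont.locallyIntegrable) (by
    intro φ hφ hc
    have hd : Continuous (deriv φ) := hφ.continuous_deriv (by simp)
    simp only [Pi.sub_apply, smul_sub]
    rw [integral_sub (u.toL2.integrable_smul hd hc.deriv)
      (hcont.locallyIntegrable.integrable_smul_left_of_hasCompactSupport hd hc.deriv),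
      u.hasWeakDeriv φ hφ hc, integral_deriv_smul_primitive hg hφ hc, sub_self])
  refine ⟨C, ?_⟩
  filter_upwards [hC] with x hx
  rw [← hx]
  simp

theorem H1.exists_continuous_rep (u : H1) :
    ∃ f : ℝ → ℂ, Continuous f ∧ u.toL2 =ᵐ[volume] f := by
  obtain ⟨C, hC⟩ := u.exists_primitive
  exact ⟨_, continuous_const.add (intervalIntegral.continuous_primitive
    (intervalIntegrable_of_locallyIntegrable u.weakDeriv.locallyIntegrable) 0), hC⟩

/-- The continuous representative of an element of `H¹(ℝ)`. -/
def H1.rep (u : H1) : ℝ → ℂ := Classical.choose u.exists_continuous_rep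

theorem H1.continuous_rep (u : H1) : Continuous u.rep :=
  (Classical.choose_spec u.exists_continuous_rep).1

theorem H1.rep_ae (u : H1) : u.toL2 =ᵐ[volume] u.rep :=
  (Classical.choose_spec u.exists_continuous_rep).2

theorem H1.rep_eq_of_ae (u : H1) {f : ℝ → ℂ} (hf : Continuous f)
    (h : u.toL2 =ᵐ[volume] f) : u.rep = f :=
  (u.continuous_rep.ae_eq_iff_eq volume hf).1 (u.rep_ae.symm.trans h)

theorem H1.rep_add (u v : H1) (x : ℝ) : (u + v).rep x = u.rep x + v.rep x := by
  refine congrFun (H1.rep_eq_of_ae (u + v) (u.continuous_rep.add v.continuous_rep) ?_) x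
  rw [map_add]
  filter_upwards [Lp.coeFn_add u.toL2 v.toL2, u.rep_ae, v.rep_ae] with y h1 h2 h3
  rw [h1, Pi.add_apply, Pi.add_apply, h2, h3]

theorem H1.rep_smul (c : ℂ) (u : H1) (x : ℝ) : (c • u).rep x = c * u.rep x := by
  refine congrFun (H1.rep_eq_of_ae (c • u) (u.continuous_rep.const_smul c) ?_) x
  rw [map_smul]
  filter_upwards [Lp.coeFn_smul c u.toL2, u.rep_ae] with y h1 h2
  rw [h1, Pi.smul_apply, h2, Pi.smul_apply]

theorem H1.rep_sub_rep (u : H1) (x y : ℝ) :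
    u.rep y - u.rep x = ∫ t in x..y, u.weakDeriv t := by
  have hi := intervalIntegrable_of_locallyIntegrable u.weakDeriv.locallyIntegrable
  obtain ⟨C, hC⟩ := u.exists_primitive
  rw [u.rep_eq_of_ae (continuous_const.add (intervalIntegral.continuous_primitive hi 0)) hC,
    ← intervalIntegral.integral_interval_sub_left (hi 0 y) (hi 0 x)]
  simp only [Pi.add_apply]
  ring

theorem L2.integral_norm_le (f : L2) (x : ℝ) : ∫ t in x..x + 1, ‖f t‖ ≤ ‖f‖ := by
  have : IsProbabilityMeasure (volume.restrict (Ioc x (x + 1))) := ⟨by simp⟩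
  have hm := (Lp.memLp f).restrict (Ioc x (x + 1))
  rw [intervalIntegral.integral_of_le (by linarith), integral_norm_eq_lintegral_enorm hm.1,
    ← eLpNorm_one_eq_lintegral_enorm, Lp.norm_def]
  refine ENNReal.toReal_mono (Lp.memLp f).2.ne ?_
  exact (eLpNorm_le_eLpNorm_of_exponent_le one_le_two hm.1).trans
    (eLpNorm_mono_measure _ Measure.restrict_le_self)

theorem H1.norm_rep_le (u : H1) (x : ℝ) : ‖u.rep x‖ ≤ ‖u.toL2‖ + ‖u.weakDeriv‖ := by
  have hx : x ≤ x + 1 := by linarith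
  have hgi : ∀ a b, IntervalIntegrable (fun t => ‖u.weakDeriv t‖) volume a b := fun a b =>
    (intervalIntegrable_of_locallyIntegrable u.weakDeriv.locallyIntegrable a b).norm
  have h1 : ∀ y ∈ Icc x (x + 1), ‖u.rep x‖ ≤ ‖u.rep y‖ + ‖u.weakDeriv‖ := by
    intro y hy
    have e : u.rep x = u.rep y - ∫ t in x..y, u.weakDeriv t := by
      rw [← u.rep_sub_rep]; ring
    rw [e]
    refine (norm_sub_le _ _).trans ?_
    gcongr
    calc ‖∫ t in x..y, u.weakDeriv t‖ ≤ ∫ t in x..y, ‖u.weakDeriv t‖ :=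
          intervalIntegral.norm_integral_le_integral_norm hy.1
      _ ≤ ∫ t in x..x + 1, ‖u.weakDeriv t‖ :=
          intervalIntegral.integral_mono_interval le_rfl hy.1 hy.2
            (Filter.Eventually.of_forall fun _ => norm_nonneg _) (hgi _ _)
      _ ≤ _ := L2.integral_norm_le _ _
  have hc : Continuous fun y => ‖u.rep y‖ + ‖u.weakDeriv‖ :=
    u.continuous_rep.norm.add continuous_const
  have h2 : ∫ _ in x..x + 1, ‖u.rep x‖ ≤ ∫ y in x..x + 1, (‖u.rep y‖ + ‖u.weakDeriv‖) :=
    intervalIntegral.integral_mono_on hx (by simp) (hc.intervalIntegrable _ _) h1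
  rw [intervalIntegral.integral_add (u.continuous_rep.norm.intervalIntegrable _ _) (by simp)]
    at h2
  have h3 : ∫ y in x..x + 1, ‖u.rep y‖ = ∫ y in x..x + 1, ‖u.toL2 y‖ := by
    refine intervalIntegral.integral_congr_ae ?_
    filter_upwards [u.rep_ae] with y hy _
    rw [hy]
  simp only [intervalIntegral.integral_const, add_sub_cancel_left, one_smul] at h2
  linarith [L2.integral_norm_le u.toL2 x]

/-! ### The space `H⁻¹(ℝ)` and the operator `-d²/dx² - Zδ(x)` -/

/-- `H⁻¹(ℝ)`, the topological dual of `H¹(ℝ)` with the dual norm. -/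
abbrev Hneg1 : Type := H1 →L[ℂ] ℂ

/-- The bilinear pairing `(f, g) ↦ ∫ f g` on `L²(ℝ)`. -/
def pairing : L2 →L[ℂ] L2 →L[ℂ] ℂ :=
  (ContinuousLinearMap.mul ℂ ℂ).lpPairing (volume : Measure ℝ) 2 2

theorem pairing_apply (f g : L2) : pairing f g = ∫ x, f x * g x := by
  simp [pairing, ContinuousLinearMap.lpPairing_eq_integral]

/-- The embedding `L²(ℝ) → H⁻¹(ℝ)`, `f ↦ (v ↦ ∫ f v)`. -/
def L2.toHneg1 : L2 →L[ℂ] Hneg1 :=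
  pairing.bilinearComp (ContinuousLinearMap.id ℂ L2) H1.toL2

theorem L2.toHneg1_apply (f : L2) (v : H1) : f.toHneg1 v = ∫ x, f x * v.toL2 x := by
  rw [← pairing_apply]
  rfl

/-- The embedding `H¹(ℝ) → H⁻¹(ℝ)`. -/
def H1.toHneg1 : H1 →L[ℂ] Hneg1 := L2.toHneg1.comp H1.toL2

/-- The Dirac distribution `δ ∈ H⁻¹(ℝ)`, `v ↦ v(0)`. -/
def dirac0 : Hneg1 :=
  LinearMap.mkContinuous
    { toFun := fun v => v.rep 0
      map_add' := fun u v => H1.rep_add u v 0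
      map_smul' := fun c u => H1.rep_smul c u 0 }
    (‖H1.toL2‖ + ‖H1.weakDeriv‖) fun v => by
      refine (v.norm_rep_le 0).trans ?_
      rw [add_mul]
      exact add_le_add (H1.toL2.le_opNorm v) (H1.weakDeriv.le_opNorm v)

theorem dirac0_apply (v : H1) : dirac0 v = v.rep 0 := rfl

/-- The operator `-d²/dx² : H¹(ℝ) → H⁻¹(ℝ)` in the sense of distributions,
`⟨-u'', v⟩ = ∫ u' v'`. -/
def negLaplacian : H1 →L[ℂ] Hneg1 :=
  pairing.bilinearComp H1.weakDeriv H1.weakDeriv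

/-- The operator `A_Z = -d²/dx² - Zδ(x) : H¹(ℝ) → H⁻¹(ℝ)`, that is `A_Z u = -u'' - Z u(0) δ`. -/
def pointInteraction (Z : ℝ) : H1 →L[ℂ] Hneg1 :=
  negLaplacian - (Z : ℂ) • dirac0.smulRight dirac0

theorem pointInteraction_apply (Z : ℝ) (u v : H1) :
    pointInteraction Z u v =
      (∫ x, u.weakDeriv x * v.weakDeriv x) - Z * (u.rep 0 * v.rep 0) := by
  rw [← pairing_apply]
  rfl

/-! ### The operator `A_Z` on its domain -/

theorem L2.integrable_mul (f g : L2) : Integrable (fun x => f x * g x) volume :=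
  (Lp.memLp f).integrable_mul (Lp.memLp g)

/-- The graph in `L²(ℝ)` of the self-adjoint operator `A_Z`: its domain consists of the
`g ∈ H¹(ℝ) ∩ H²(ℝ ∖ {0})` with `g'(0+) - g'(0-) = -Z g(0)`, and `A_Z g = -g''` off the origin.
Here `a = g'(0+)`, `b = g'(0-)` and `h = -g''`. -/
def operatorGraph (Z : ℝ) : Set (H1 × L2) :=
  {p | ∃ a b : ℂ, a - b = -Z * p.1.rep 0 ∧
    p.1.weakDeriv =ᵐ[volume] fun x => (if 0 < x then a else b) - ∫ t in (0 : ℝ)..x, p.2 t}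

/-- On its domain, the self-adjoint operator `A_Z` agrees with
`-d²/dx² - Zδ(x) : H¹(ℝ) → H⁻¹(ℝ)`. -/
theorem pointInteraction_eq_of_mem_operatorGraph (Z : ℝ) (g : H1) (h : L2)
    (hg : (g, h) ∈ operatorGraph Z) : pointInteraction Z g = h.toHneg1 := by
  obtain ⟨a, b, hab, hd⟩ := hg
  ext v
  rw [pointInteraction_apply, L2.toHneg1_apply]
  have hv := v.weakDeriv.locallyIntegrable
  have hh := h.locallyIntegrable
  have hih := intervalIntegrable_of_locallyIntegrable hh
  have iF1 := g.weakDeriv.integrable_mul v.weakDeriv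
  have iF2 := h.integrable_mul v.toL2
  let F : ℝ → ℂ := fun x => g.weakDeriv x * v.weakDeriv x - h x * v.toL2 x
  have iF : Integrable F volume := iF1.sub iF2
  let G : ℂ → ℝ → ℂ := fun c x => c - ∫ t in (0 : ℝ)..x, h t
  have hrep : ∀ x, v.rep 0 + ∫ t in (0 : ℝ)..x, v.weakDeriv t = v.rep x := fun x => by
    rw [← v.rep_sub_rep]; ring
  have hneg : LocallyIntegrable (fun x => -h x) volume := hh.neg
  have key : ∀ (c : ℂ) (R : ℝ), (∀ᵐ x, x ∈ uIoc 0 R → g.weakDeriv x = G c x) →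
      ∫ x in (0 : ℝ)..R, F x = G c R * v.rep R - c * v.rep 0 := by
    intro c R hc
    have e := integral_by_parts hneg hv c (v.rep 0) 0 R
    simp only [hrep, intervalIntegral.integral_neg, ← sub_eq_add_neg] at e
    rw [← e]
    refine intervalIntegral.integral_congr_ae ?_
    filter_upwards [hc, v.rep_ae] with x h1 h2 hx
    simp only [F, h1 hx, h2, G]
    ring
  have iGv : ∀ c, ∀ s : Set ℝ, MeasurableSet s → (∀ᵐ x, x ∈ s → g.weakDeriv x = G c x) →
      IntegrableOn (fun x => G c x * v.rep x) s volume := by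
    intro c s hs hc
    refine (g.weakDeriv.integrable_mul v.toL2).integrableOn.congr_fun_ae ?_
    rw [Filter.EventuallyEq, ae_restrict_iff' hs]
    filter_upwards [hc, v.rep_ae] with x h1 h2 hx
    rw [h1 hx, h2]
  have hpos : ∀ᵐ x, x ∈ Ioi (0 : ℝ) → g.weakDeriv x = G a x := by
    filter_upwards [hd] with x hx h0
    simpa [G, if_pos (mem_Ioi.1 h0)] using hx
  have hnp : ∀ᵐ x, x ∈ Iic (0 : ℝ) → g.weakDeriv x = G b x := by
    filter_upwards [hd] with x hx h0
    simpa [G, if_neg (not_lt.2 (mem_Iic.1 h0))] using hx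
  have t1 := intervalIntegral_tendsto_integral_Ioi 0 iF.integrableOn Filter.tendsto_id
  have t2 := intervalIntegral_tendsto_integral_Iic 0 iF.integrableOn Filter.tendsto_id
  have e1 : (∫ x in Ioi 0, F x) + a * v.rep 0 = 0 := by
    refine IntegrableAtFilter.eq_zero_of_tendsto
      ⟨Ioi 0, Filter.Ioi_mem_atTop 0, iGv a _ measurableSet_Ioi hpos⟩ (fun s hs => ?_)
      ((t1.add_const (a * v.rep 0)).congr' ?_)
    · obtain ⟨r, hr⟩ := Filter.mem_atTop_sets.1 hs
      exact measure_mono_top (s₁ := Ici r) (fun x hx => hr x hx) (by simp)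
    · filter_upwards [Filter.Ioi_mem_atTop 0] with R hR
      rw [id, key a R]
      · ring
      · rw [uIoc_of_le (le_of_lt hR)]
        filter_upwards [hpos] with x hx h0 using hx h0.1
  have e2 : -(∫ x in Iic 0, F x) + b * v.rep 0 = 0 := by
    refine IntegrableAtFilter.eq_zero_of_tendsto
      ⟨Iic 0, Filter.Iic_mem_atBot 0, iGv b _ measurableSet_Iic hnp⟩ (fun s hs => ?_)
      ((t2.neg.add_const (b * v.rep 0)).congr' ?_)
    · obtain ⟨r, hr⟩ := Filter.mem_atBot_sets.1 hs
      exact measure_mono_top (s₁ := Iic r) (fun x hx => hr x hx) (by simp)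
    · filter_upwards [Filter.Iic_mem_atBot 0] with R hR
      rw [id, ← intervalIntegral.integral_symm, key b R]
      · ring
      · rw [uIoc_of_ge hR]
        filter_upwards [hnp] with x hx h0 using hx h0.2
  have e3 : ∫ x, F x = (∫ x in Iic 0, F x) + ∫ x in Ioi 0, F x := by
    rw [← setIntegral_union (Iic_disjoint_Ioi le_rfl) measurableSet_Ioi iF.integrableOn
      iF.integrableOn, Iic_union_Ioi, setIntegral_univ]
  have e4 : ∫ x, F x = (∫ x, g.weakDeriv x * v.weakDeriv x) - ∫ x, h x * v.toL2 x :=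
    integral_sub iF1 iF2
  dsimp only at hab
  linear_combination e1 - e2 - e4 + e3 - v.rep 0 * hab

/-! ### The nonlinearity -/

theorem H1.memLp_nonlinearity (l₁ l₂ : ℝ) (u : H1) :
    MemLp (fun x => ((l₁ * ‖u.toL2 x‖ ^ 2 + l₂ * ‖u.toL2 x‖ ^ 4 : ℝ) : ℂ) * u.toL2 x) 2
      volume := by
  have hm := (Lp.memLp u.toL2).1
  set M := ‖u.toL2‖ + ‖u.weakDeriv‖
  refine MemLp.of_le_mul (c := |l₁| * M ^ 2 + |l₂| * M ^ 4) (Lp.memLp u.toL2) ?_ ?_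
  · refine AEStronglyMeasurable.mul (Complex.continuous_ofReal.comp_aestronglyMeasurable ?_) hm
    exact ((hm.norm.pow 2).const_mul l₁).add ((hm.norm.pow 4).const_mul l₂)
  · filter_upwards [u.rep_ae] with x hx
    have hb : ‖u.toL2 x‖ ≤ M := hx ▸ u.norm_rep_le x
    rw [norm_mul, Complex.norm_real, Real.norm_eq_abs]
    gcongr
    refine (abs_add_le _ _).trans ?_
    rw [abs_mul, abs_mul, abs_of_nonneg (pow_nonneg (norm_nonneg _) 2),
      abs_of_nonneg (pow_nonneg (norm_nonneg _) 4)]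
    gcongr

/-- The nonlinearity `F(u) = λ₁|u|²u + λ₂|u|⁴u`, as an element of `L²(ℝ)`. -/
def nonlinearity (l₁ l₂ : ℝ) (u : H1) : L2 := (u.memLp_nonlinearity l₁ l₂).toLp _

/-! ### Solutions -/

/-- `u ∈ C([-T,T]; H¹) ∩ C¹([-T,T]; H⁻¹)` solves
`i u_t - A_Z u + (λ₁|u|² + λ₂|u|⁴) u = 0` in `H⁻¹(ℝ)` on `[-T,T]`, with `u(0) = u₀`.
The function `w` is the time derivative `u_t ∈ C([-T,T]; H⁻¹)`, one-sided at the endpoints. -/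
def IsSolution (Z l₁ l₂ : ℝ) {T : ℝ} (hT : 0 < T) (u₀ : H1) (u : C(Icc (-T) T, H1)) : Prop :=
  u ⟨0, neg_nonpos.2 hT.le, hT.le⟩ = u₀ ∧
  ∃ w : C(Icc (-T) T, Hneg1), ∀ t : Icc (-T) T,
    HasDerivWithinAt (fun s : ℝ => (IccExtend (neg_le_self hT.le) u s).toHneg1) (w t)
      (Icc (-T) T) t ∧
    Complex.I • w t - pointInteraction Z (u t) + (nonlinearity l₁ l₂ (u t)).toHneg1 = 0

/-- The data in `H¹(ℝ)` that admit a solution on `[-T,T]`. -/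
def solvableData (Z l₁ l₂ : ℝ) {T : ℝ} (hT : 0 < T) : Set H1 :=
  {u₀ | ∃ u, IsSolution Z l₁ l₂ hT u₀ u}

/-- An element of `H¹(ℝ)` is even if its continuous representative is an even function. -/
def H1.IsEven (u : H1) : Prop := Function.Even u.rep

end
end NLSDelta

/-!
# Local well-posedness of the cubic-quintic Schrödinger equation with a delta interaction

For large `m` the form `∫ |u'|² + m ∫ |u|² - Z |u(0)|²` is coercive on `H¹(ℝ)`, by a trace
inequality with a small factor in front of the derivative. Hence `J = A_Z + m` is an isomorphism of
`H¹(ℝ)` onto `H⁻¹(ℝ)`, and with `K = J⁻¹`, restricted to `H¹(ℝ)`, the equation becomes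
`(Ku)' = -i(u - KF(u))` in the single Hilbert space `H¹(ℝ)`, where
`F(u) = mu + λ₁|u|²u + λ₂|u|⁴u`. As `H¹(ℝ)` is an algebra with a conjugation, `F` is a real
polynomial map of `H¹(ℝ)` to itself; in particular it is smooth, and Lipschitz on bounded sets.

The operator `K` is bounded, injective, and conjugate to a self-adjoint operator
(`exists_isPropagator_of_coercive`). The functions `r e^{-it/r}` are continuous on the real line, so
the continuous functional calculus yields `exp(-itK⁻¹)K`, and by density the bounded, strongly
continuous group `U(t) = exp(-itK⁻¹)` (`exists_isPropagator_of_isSelfAdjoint`). In the interaction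
picture `v(t) = U(-t)u(t)` the equation is the ordinary differential equation
`v' = iU(-t)F(U(t)v)` in integral form (`IsPropagator.duhamel_iff`, `isSolution_iff`). Its right-hand
side is continuous in time and Lipschitz on balls in `v`, so that the Picard–Lindelöf theorem and
Grönwall's inequality give existence and uniqueness.

For the dependence on the data, `v - u₀ - ∫₀ᵗ iU(-s)F(U(s)v(s)) ds = 0` is an equation between
elements of `C([-T,T]; H¹)` that depends smoothly on `(u₀, v)`. The derivative in `v` is the identity
minus a Volterra operator, which is quasinilpotent; the implicit function theorem therefore solves the
equation near each solvable datum, smoothly in the datum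
(`IsIntegralSolution.exists_contDiffAt`). This shows at once that the set of solvable data is open and
that the data-to-solution map is smooth. Evenness is preserved by uniqueness, as the reflection of a
solution is a solution (`IsSolution.reflect`).
-/

namespace NLSDelta

noncomputable section

/-! ### The unitary group generated by the inverse of a bounded self-adjoint operator -/

/-- The function `z ↦ r e^{-it/r}` with `r = re z`, which vanishes for `r = 0`. It is evaluated
only on the spectrum of a self-adjoint operator, where `z = r`. -/
def phase (t : ℝ) (z : ℂ) : ℂ := z.re * Complex.exp (((-t / z.re : ℝ) : ℂ) * Complex.I)

theorem norm_phase (t : ℝ) (z : ℂ) : ‖phase t z‖ = |z.re| := by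
  rw [phase, norm_mul, Complex.norm_exp_ofReal_mul_I, mul_one, Complex.norm_real, Real.norm_eq_abs]

theorem continuous_phase (t : ℝ) : Continuous (phase t) := by
  rw [continuous_iff_continuousAt]
  intro z
  by_cases hz : z.re = 0
  · have h0 : phase t z = 0 := by simp [phase, hz]
    rw [ContinuousAt, h0, tendsto_zero_iff_norm_tendsto_zero]
    simp only [norm_phase]
    have : Continuous fun w : ℂ => |w.re| := Complex.continuous_re.abs
    simpa [hz] using this.tendsto z
  · unfold phase
    have : ContinuousAt (fun w : ℂ => -t / w.re) z :=
      continuousAt_const.div Complex.continuous_re.continuousAt hz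
    fun_prop

theorem phase_zero (z : ℂ) : phase 0 z = z.re := by simp [phase]

theorem phase_mul_phase (s t : ℝ) (z : ℂ) :
    phase s z * phase t z = phase (s + t) z * z.re := by
  have : Complex.exp (((-(s + t) / z.re : ℝ) : ℂ) * Complex.I) =
      Complex.exp (((-s / z.re : ℝ) : ℂ) * Complex.I) *
        Complex.exp (((-t / z.re : ℝ) : ℂ) * Complex.I) := by
    rw [← Complex.exp_add]
    congr 1
    push_cast
    ring
  rw [phase, phase, phase, this]
  ring

theorem star_phase_mul_phase (t : ℝ) (z : ℂ) :
    star (phase t z) * phase t z = z.re * z.re := by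
  rw [Complex.star_def, Complex.conj_mul', norm_phase, ← Complex.ofReal_pow, sq_abs,
    Complex.ofReal_pow, sq]

theorem norm_exp_mul_I_sub_one_sub_le (θ : ℝ) :
    ‖Complex.exp (θ * Complex.I) - 1 - θ * Complex.I‖ ≤ 3 * θ ^ 2 := by
  have hn : ‖(θ : ℂ) * Complex.I‖ = |θ| := by simp
  rcases le_total |θ| 1 with h | h
  · have := Complex.norm_exp_sub_one_sub_id_le (x := θ * Complex.I) (by rwa [hn])
    rw [hn, sq_abs] at this
    nlinarith [sq_nonneg θ]
  · refine (norm_sub_le _ _).trans ?_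
    have h1 := norm_sub_le (Complex.exp (θ * Complex.I)) 1
    rw [Complex.norm_exp_ofReal_mul_I, norm_one] at h1
    rw [hn, ← sq_abs]
    nlinarith

theorem norm_phase_increment_le (t h : ℝ) (z : ℂ) :
    ‖(phase (t + h) z * z.re - phase t z * z.re) + (Complex.I * h) * phase t z‖ ≤ 3 * h ^ 2 := by
  by_cases hz : z.re = 0
  · simp [phase, hz]
    positivity
  have hz' : (z.re : ℂ) ≠ 0 := by exact_mod_cast hz
  have e : (phase (t + h) z * z.re - phase t z * z.re) + (Complex.I * h) * phase t z =
      phase t z * z.re *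
        (Complex.exp (((-h / z.re : ℝ) : ℂ) * Complex.I) - 1 -
          ((-h / z.re : ℝ) : ℂ) * Complex.I) := by
    rw [mul_sub, mul_sub, ← phase_mul_phase, mul_one]
    unfold phase
    push_cast
    field_simp
    ring
  rw [e, norm_mul, norm_mul, norm_phase, Complex.norm_real, Real.norm_eq_abs]
  refine (mul_le_mul_of_nonneg_left (norm_exp_mul_I_sub_one_sub_le _) (by positivity)).trans ?_
  rw [← sq, sq_abs, div_pow, neg_sq]
  apply le_of_eq
  field_simp

/-- `U` is a strongly continuous bounded group with generator `-iK⁻¹`, where `K` is injective: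
formally `U t = exp(-itK⁻¹)`. -/
structure IsPropagator {X : Type*} [NormedAddCommGroup X] [NormedSpace ℂ X]
    (K : X →L[ℂ] X) (U : ℝ → X →L[ℂ] X) : Prop where
  zero_apply : ∀ x, U 0 x = x
  add_apply : ∀ s t x, U (s + t) x = U s (U t x)
  bounded : ∃ C, ∀ t, ‖U t‖ ≤ C
  continuous_apply : ∀ x, Continuous fun t => U t x
  commute : ∀ t x, K (U t x) = U t (K x)
  hasDerivAt : ∀ t x, HasDerivAt (fun s => K (U s x)) (-Complex.I • U t x) t

section Group

variable {X : Type*} [NormedAddCommGroup X] [InnerProductSpace ℂ X] [CompleteSpace X]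

theorem cfc_re_eq {K : X →L[ℂ] X} (hK : IsSelfAdjoint K) : cfc (fun z : ℂ => (z.re : ℂ)) K = K := by
  have : IsStarNormal K := hK.isStarNormal
  conv_rhs => rw [← cfc_id' ℂ K]
  exact cfc_congr fun z hz => (hK.mem_spectrum_eq_re hz).symm

theorem denseRange_of_isSelfAdjoint {K : X →L[ℂ] X} (hK : IsSelfAdjoint K)
    (hinj : Function.Injective K) : DenseRange K := by
  have h : K.rangeᗮ = ⊥ := by
    rw [ContinuousLinearMap.orthogonal_range, hK.adjoint_eq]
    exact LinearMap.ker_eq_bot.2 hinj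
  have := (Submodule.topologicalClosure_eq_top_iff (K := K.range)).2 h
  exact Submodule.dense_iff_topologicalClosure_eq_top.2 this

/-- The operator `cfc (r e^{-it/r}) K`, which is `exp(-itK⁻¹) K`. -/
def groupMulSelf (K : X →L[ℂ] X) (t : ℝ) : X →L[ℂ] X := cfc (phase t) K

theorem groupMulSelf_zero {K : X →L[ℂ] X} (hK : IsSelfAdjoint K) : groupMulSelf K 0 = K := by
  conv_rhs => rw [← cfc_re_eq hK]
  exact cfc_congr fun z _ => phase_zero z

theorem groupMulSelf_mul {K : X →L[ℂ] X} (hK : IsSelfAdjoint K) (s t : ℝ) :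
    groupMulSelf K s * groupMulSelf K t = groupMulSelf K (s + t) * K := by
  have : IsStarNormal K := hK.isStarNormal
  have h1 := cfc_mul (phase s) (phase t) K (continuous_phase s).continuousOn
    (continuous_phase t).continuousOn
  have h2 := cfc_mul (phase (s + t)) (fun z : ℂ => (z.re : ℂ)) K
    (continuous_phase _).continuousOn (by fun_prop)
  rw [cfc_re_eq hK] at h2
  rw [groupMulSelf, groupMulSelf, groupMulSelf, ← h1, ← h2]
  exact cfc_congr fun z _ => phase_mul_phase s t z

theorem groupMulSelf_commute {K : X →L[ℂ] X} (hK : IsSelfAdjoint K) (t : ℝ) :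
    Commute K (groupMulSelf K t) := by
  have := cfc_commute_cfc (fun z : ℂ => (z.re : ℂ)) (phase t) K
  rwa [cfc_re_eq hK] at this

theorem star_groupMulSelf_mul {K : X →L[ℂ] X} (hK : IsSelfAdjoint K) (t : ℝ) :
    star (groupMulSelf K t) * groupMulSelf K t = K * K := by
  have : IsStarNormal K := hK.isStarNormal
  conv_rhs => rw [← cfc_re_eq hK, ← cfc_mul _ _ _ (by fun_prop) (by fun_prop)]
  rw [groupMulSelf, ← cfc_star, ← cfc_mul _ _ _ (continuous_phase t).star.continuousOn
    (continuous_phase t).continuousOn]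
  exact cfc_congr fun z _ => star_phase_mul_phase t z

theorem norm_groupMulSelf_apply {K : X →L[ℂ] X} (hK : IsSelfAdjoint K) (t : ℝ) (x : X) :
    ‖groupMulSelf K t x‖ = ‖K x‖ := by
  have h : ∀ A : X →L[ℂ] X, ((‖A x‖ ^ 2 : ℝ) : ℂ) = inner ℂ ((star A * A) x) x := fun A => by
    rw [mul_apply_eq_comp, ContinuousLinearMap.star_eq_adjoint,
      ContinuousLinearMap.adjoint_inner_left, inner_self_eq_norm_sq_to_K]
    norm_cast
  have h1 := h (groupMulSelf K t)
  have h2 := h K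
  rw [hK.star_eq] at h2
  rw [star_groupMulSelf_mul hK, ← h2] at h1
  have h3 : ‖groupMulSelf K t x‖ ^ 2 = ‖K x‖ ^ 2 := by exact_mod_cast h1
  exact (pow_left_inj₀ (norm_nonneg _) (norm_nonneg _) two_ne_zero).1 h3

theorem norm_groupMulSelf_increment_le {K : X →L[ℂ] X} (hK : IsSelfAdjoint K) (t h : ℝ) :
    ‖(groupMulSelf K (t + h) * K - groupMulSelf K t * K) +
      (Complex.I * h) • groupMulSelf K t‖ ≤ 3 * h ^ 2 := by
  have : IsStarNormal K := hK.isStarNormal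
  have hc := fun s => (continuous_phase s).continuousOn (s := spectrum ℂ K)
  have hr : ContinuousOn (fun z : ℂ => (z.re : ℂ)) (spectrum ℂ K) := by fun_prop
  have e : cfc (fun z => (phase (t + h) z * z.re - phase t z * z.re) +
      (Complex.I * h) * phase t z) K = (groupMulSelf K (t + h) * K - groupMulSelf K t * K) +
      (Complex.I * h) • groupMulSelf K t := by
    have hm := fun s => (hc s).mul hr
    rw [cfc_add (a := K) (fun z => phase (t + h) z * z.re - phase t z * z.re)
        (fun z => (Complex.I * h) * phase t z) ((hm _).sub (hm _)) (continuousOn_const.mul (hc _)),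
      cfc_sub (a := K) (fun z => phase (t + h) z * z.re) (fun z => phase t z * z.re) (hm _) (hm _),
      cfc_mul _ _ K (hc _) hr, cfc_mul _ _ K (hc _) hr, cfc_const_mul _ _ K (hc _), cfc_re_eq hK]
    rfl
  rw [← e]
  exact norm_cfc_le (by positivity) fun z _ => norm_phase_increment_le t h z

/-- On the range of `K`, the group has derivative `-iK⁻¹`: the remainder
`r² (e^{-ih/r} - 1 + ih/r)` is of order `h²` uniformly in `r`. -/
theorem hasDerivAt_groupMulSelf {K : X →L[ℂ] X} (hK : IsSelfAdjoint K) (t : ℝ) (y : X) :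
    HasDerivAt (fun s => groupMulSelf K s (K y)) (-Complex.I • groupMulSelf K t y) t := by
  rw [hasDerivAt_iff_isLittleO_nhds_zero]
  refine Asymptotics.IsBigO.trans_isLittleO (g := fun h : ℝ => h ^ 2) ?_
    (Asymptotics.isLittleO_pow_id one_lt_two)
  refine Asymptotics.IsBigO.of_bound (3 * ‖y‖) (Filter.Eventually.of_forall fun h => ?_)
  have e : groupMulSelf K (t + h) (K y) - groupMulSelf K t (K y) -
      h • (-Complex.I • groupMulSelf K t y) =
      ((groupMulSelf K (t + h) * K - groupMulSelf K t * K) +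
      (Complex.I * h) • groupMulSelf K t) y := by
    simp only [add_apply, sub_apply, mul_apply_eq_comp, smul_apply, neg_smul, smul_neg,
      sub_neg_eq_add, mul_smul, Complex.coe_smul, smul_comm h]
  rw [e]
  refine (ContinuousLinearMap.le_opNorm _ _).trans ?_
  refine (mul_le_mul_of_nonneg_right (norm_groupMulSelf_increment_le hK t h)
    (norm_nonneg _)).trans ?_
  rw [norm_pow, Real.norm_eq_abs, sq_abs]
  apply le_of_eq
  ring

/-- Stone's theorem for the inverse of a bounded injective self-adjoint operator `K`. The function
`e^{-it/r}` is discontinuous at `r = 0`, but `r e^{-it/r}` is not, so the continuous functional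
calculus provides `exp(-itK⁻¹)` on the dense range of `K`, from where it is extended. -/
theorem exists_isPropagator_of_isSelfAdjoint {K : X →L[ℂ] X} (hK : IsSelfAdjoint K)
    (hinj : Function.Injective K) : ∃ U : ℝ → X →L[ℂ] X, IsPropagator K U := by
  have hd : DenseRange K := denseRange_of_isSelfAdjoint hK hinj
  have hb : ∀ t x, ‖groupMulSelf K t x‖ ≤ 1 * ‖K x‖ := fun t x => by
    rw [norm_groupMulSelf_apply hK, one_mul]
  let U : ℝ → X →L[ℂ] X := fun t =>
    (groupMulSelf K t : X →ₗ[ℂ] X).extendOfNorm (K : X →ₗ[ℂ] X)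
  have hU : ∀ t x, U t (K x) = groupMulSelf K t x := fun t x =>
    LinearMap.extendOfNorm_eq (f := (groupMulSelf K t : X →ₗ[ℂ] X)) (e := (K : X →ₗ[ℂ] X))
      hd ⟨1, hb t⟩ x
  have hn : ∀ t x, ‖U t x‖ ≤ 1 * ‖x‖ := fun t x =>
    LinearMap.norm_extendOfNorm_apply_le (f := (groupMulSelf K t : X →ₗ[ℂ] X))
      (e := (K : X →ₗ[ℂ] X)) hd 1 (hb t) x
  have hcomm : ∀ t x, K (groupMulSelf K t x) = groupMulSelf K t (K x) := fun t x =>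
    DFunLike.congr_fun (groupMulSelf_commute hK t).eq x
  have hcommU : ∀ t x, K (U t x) = U t (K x) := fun t x =>
    hd.induction_on (p := fun x => K (U t x) = U t (K x)) x
      (isClosed_eq (by fun_prop) (by fun_prop))
      fun y => by rw [hU, hU, hcomm]
  have hderiv : ∀ t x, HasDerivAt (fun s => K (U s x)) (-Complex.I • U t x) t := by
    intro t x
    -- Approximation of `x` by elements `K y`, with uniform convergence of the derivatives.
    obtain ⟨y, hy⟩ : ∃ y : ℕ → X, Filter.Tendsto (fun n => K (y n)) Filter.atTop (nhds x) := by
      obtain ⟨w, hw, hl⟩ := mem_closure_iff_seq_limit.1 (hd x)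
      choose y hy using hw
      exact ⟨y, by simpa only [hy] using hl⟩
    refine hasDerivAt_of_tendstoUniformly (l := Filter.atTop)
      (f := fun (n : ℕ) s => K (U s (K (y n))))
      (f' := fun (n : ℕ) s => -Complex.I • U s (K (y n))) (g' := fun s => -Complex.I • U s x)
      ?_ (Filter.Eventually.of_forall fun n s => ?_) (fun s => ?_) t
    · rw [Metric.tendstoUniformly_iff]
      intro ε hε
      filter_upwards [Metric.tendsto_nhds.1 hy ε hε] with n h s
      rw [dist_eq_norm, ← smul_sub, ← map_sub, norm_smul, norm_neg, Complex.norm_I, one_mul]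
      refine (hn _ _).trans_lt ?_
      rwa [one_mul, ← dist_eq_norm, dist_comm]
    · simp only [hU, hcomm]
      exact hasDerivAt_groupMulSelf hK s (y n)
    · exact ((K.continuous.comp (U s).continuous).tendsto x).comp hy
  refine ⟨U, ⟨fun x => ?_, fun s t x => ?_, ⟨1, fun t => ?_⟩, fun x => ?_, hcommU, hderiv⟩⟩
  · refine hd.induction_on (p := fun x => U 0 x = x) x (isClosed_eq (by fun_prop) (by fun_prop))
      fun y => ?_
    rw [hU, groupMulSelf_zero hK]
  · refine hd.induction_on (p := fun x => U (s + t) x = U s (U t x)) x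
      (isClosed_eq (by fun_prop) (by fun_prop)) fun y => ?_
    apply hinj
    rw [hU, hU, hcommU, hU, hcomm]
    exact (DFunLike.congr_fun (groupMulSelf_mul hK s t) y).symm
  · exact ContinuousLinearMap.opNorm_le_bound _ zero_le_one (hn t)
  · have hc : ∀ y, Continuous fun t => U t (K y) := fun y => by
      simp only [← hcommU]
      exact continuous_iff_continuousAt.2 fun t => (hderiv t y).continuousAt
    obtain ⟨y, hy⟩ : ∃ y : ℕ → X, Filter.Tendsto (fun n => K (y n)) Filter.atTop (nhds x) := by
      obtain ⟨w, hw, hl⟩ := mem_closure_iff_seq_limit.1 (hd x)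
      choose y hy using hw
      exact ⟨y, by simpa only [hy] using hl⟩
    refine TendstoUniformly.continuous (p := Filter.atTop) (F := fun (n : ℕ) t => U t (K (y n)))
      ?_ (Filter.Eventually.of_forall fun n => hc _).frequently
    rw [Metric.tendstoUniformly_iff]
    intro ε hε
    filter_upwards [Metric.tendsto_nhds.1 hy ε hε] with n h s
    rw [dist_eq_norm, ← map_sub]
    refine (hn _ _).trans_lt ?_
    rwa [one_mul, ← dist_eq_norm, dist_comm]

end Group

/-- Propagators are transported by conjugation with a continuous linear equivalence. -/
theorem IsPropagator.conj {X : Type*} [NormedAddCommGroup X] [NormedSpace ℂ X]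
    {K : X →L[ℂ] X} {U : ℝ → X →L[ℂ] X} (h : IsPropagator K U) (Q : X ≃L[ℂ] X) :
    IsPropagator (((Q.symm : X →L[ℂ] X).comp K).comp (Q : X →L[ℂ] X))
      fun t => ((Q.symm : X →L[ℂ] X).comp (U t)).comp (Q : X →L[ℂ] X) where
  zero_apply x := by simp [h.zero_apply]
  add_apply s t x := by simp [h.add_apply]
  bounded := by
    obtain ⟨C, hC⟩ := h.bounded
    refine ⟨‖(Q.symm : X →L[ℂ] X)‖ * C * ‖(Q : X →L[ℂ] X)‖, fun t => ?_⟩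
    refine (ContinuousLinearMap.opNorm_comp_le _ _).trans ?_
    gcongr
    refine (ContinuousLinearMap.opNorm_comp_le _ _).trans ?_
    gcongr
    exact hC t
  continuous_apply x := Q.symm.continuous.comp (h.continuous_apply (Q x))
  commute t x := by simp [h.commute]
  hasDerivAt t x := by
    have := ((Q.symm : X →L[ℂ] X).restrictScalars ℝ).hasFDerivAt.comp_hasDerivAt t
      (h.hasDerivAt t (Q x))
    simpa [Function.comp_def] using this

/-! ### Duhamel's formula -/

/-- Product rule for a uniformly bounded, strongly continuous family of operators `A` that is
differentiable only on the vector `y t`. -/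
theorem hasDerivWithinAt_clm_apply {X : Type*} [NormedAddCommGroup X] [NormedSpace ℝ X]
    {A : ℝ → X →L[ℝ] X} {C : ℝ} (hC : ∀ t, ‖A t‖ ≤ C) {y : ℝ → X} {y' z : X} {s : Set ℝ} {t : ℝ}
    (hA : ContinuousAt (fun r => A r y') t) (hy : HasDerivWithinAt y y' s t)
    (hz : HasDerivWithinAt (fun r => A r (y t)) z s t) :
    HasDerivWithinAt (fun r => A r (y r)) (z + A t y') s t := by
  rw [hasDerivWithinAt_iff_isLittleO] at hy hz ⊢
  have h1 : (fun r => A r (y r - y t - (r - t) • y')) =o[nhdsWithin t s] fun r => r - t := by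
    refine Asymptotics.IsBigO.trans_isLittleO (.of_bound C (.of_forall fun r => ?_)) hy
    exact (A r).le_of_opNorm_le (hC r) _
  have h2 : (fun r => (r - t) • (A r y' - A t y')) =o[nhdsWithin t s] fun r => r - t := by
    have h3 : (fun r => A r y' - A t y') =o[nhdsWithin t s] fun _ => (1 : ℝ) := by
      rw [Asymptotics.isLittleO_one_iff, ← sub_self (A t y')]
      exact (hA.tendsto.mono_left nhdsWithin_le_nhds).sub_const _
    simpa using (Asymptotics.isBigO_refl (fun r : ℝ => r - t) (nhdsWithin t s)).smul_isLittleO h3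
  refine ((hz.add h1).add h2).congr_left fun r => ?_
  simp only [map_sub, map_smul, smul_add, smul_sub]
  abel

theorem eqOn_of_hasDerivWithinAt_Icc {X : Type*} [NormedAddCommGroup X] [NormedSpace ℝ X]
    {f g f' : ℝ → X} {a b c : ℝ} (hc : c ∈ Icc a b)
    (hf : ∀ t ∈ Icc a b, HasDerivWithinAt f (f' t) (Icc a b) t)
    (hg : ∀ t ∈ Icc a b, HasDerivWithinAt g (f' t) (Icc a b) t) (h : f c = g c) :
    EqOn f g (Icc a b) := by
  intro t ht
  have := Convex.norm_image_sub_le_of_norm_hasDerivWithin_le (C := 0) (f := fun t => f t - g t)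
    (f' := fun _ => 0) (fun t ht => by simpa using! (hf t ht).sub (hg t ht)) (by simp)
    (convex_Icc a b) hc ht
  rw [zero_mul, norm_le_zero_iff, h, sub_self, sub_zero, sub_eq_zero] at this
  exact this

theorem hasDerivWithinAt_integral_Icc {X : Type*} [NormedAddCommGroup X] [NormedSpace ℝ X]
    [CompleteSpace X] {g : ℝ → X} {a b c : ℝ} (hc : c ∈ Icc a b) (hg : ContinuousOn g (Icc a b))
    {t : ℝ} (ht : t ∈ Icc a b) :
    HasDerivWithinAt (fun t => ∫ s in c..t, g s) (g t) (Icc a b) t := by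
  have : Fact (t ∈ Icc a b) := ⟨ht⟩
  refine intervalIntegral.integral_hasDerivWithinAt_right
    ((hg.mono (uIcc_subset_Icc hc ht)).intervalIntegrable) ?_ (hg t ht)
  exact hg.stronglyMeasurableAtFilter_nhdsWithin measurableSet_Icc t

section

variable {X : Type*} [NormedAddCommGroup X] [NormedSpace ℂ X] {K : X →L[ℂ] X}
  {U : ℝ → X →L[ℂ] X}

theorem IsPropagator.apply_neg_apply (h : IsPropagator K U) (t : ℝ) (x : X) :
    U t (U (-t) x) = x := by
  rw [← h.add_apply, add_neg_cancel, h.zero_apply]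

theorem IsPropagator.neg_apply_apply (h : IsPropagator K U) (t : ℝ) (x : X) :
    U (-t) (U t x) = x := by
  rw [← h.add_apply, neg_add_cancel, h.zero_apply]

theorem IsPropagator.continuous_uncurry (h : IsPropagator K U) :
    Continuous fun p : ℝ × X => U p.1 p.2 := by
  obtain ⟨C, hC⟩ := h.bounded
  have hC0 : 0 ≤ C := (norm_nonneg _).trans (hC 0)
  refine continuous_prod_of_continuous_lipschitzWith' _ ⟨C, hC0⟩ (fun t => ?_) h.continuous_apply
  exact (U t).lipschitz.weaken (hC t)

/-- The nonlinearity in the interaction picture: `u` solves `u' = -iK⁻¹u + iF(u)` if and only if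
`v(t) = U(-t)u(t)` solves `v' = interaction U F t v`. -/
def interaction (U : ℝ → X →L[ℂ] X) (F : X → X) (t : ℝ) (v : X) : X :=
  Complex.I • U (-t) (F (U t v))

theorem IsPropagator.continuous_interaction (h : IsPropagator K U) {F : X → X}
    (hF : Continuous F) : Continuous fun p : ℝ × X => interaction U F p.1 p.2 := by
  have h2 : Continuous fun p : ℝ × X => U (-p.1) (F (U p.1 p.2)) :=
    h.continuous_uncurry.comp (continuous_fst.neg.prodMk (hF.comp h.continuous_uncurry))
  exact h2.const_smul Complex.I

/-- Applying `U(-t)K` to the equation `(Ku)' = -i(u - KF(u))` removes the linear part, and the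
injectivity of `K` allows to pass from the resulting identity to Duhamel's formula. -/
theorem IsPropagator.duhamel_iff [CompleteSpace X] (h : IsPropagator K U)
    (hK : Function.Injective K) {F : X → X} (hF : Continuous F) {T : ℝ} (hT : 0 < T)
    {u : ℝ → X} (hu : ContinuousOn u (Icc (-T) T)) :
    (∀ t ∈ Icc (-T) T, HasDerivWithinAt (fun t => K (u t))
      (-Complex.I • (u t - K (F (u t)))) (Icc (-T) T) t) ↔
    ∀ t ∈ Icc (-T) T, U (-t) (u t) =
      u 0 + ∫ s in (0 : ℝ)..t, interaction U F s (U (-s) (u s)) := by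
  obtain ⟨C, hC⟩ := h.bounded
  have h0 : (0 : ℝ) ∈ Icc (-T) T := ⟨by linarith, hT.le⟩
  have hi : ∀ s, interaction U F s (U (-s) (u s)) = Complex.I • U (-s) (F (u s)) := fun s => by
    rw [interaction, h.apply_neg_apply]
  have hcont : ContinuousOn (fun s => interaction U F s (U (-s) (u s))) (Icc (-T) T) :=
    (h.continuous_interaction hF).comp_continuousOn (continuousOn_id.prodMk
      (h.continuous_uncurry.comp_continuousOn (continuous_neg.continuousOn.prodMk hu)))
  have hg : ∀ t ∈ Icc (-T) T, HasDerivWithinAt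
      (fun t => u 0 + ∫ s in (0 : ℝ)..t, interaction U F s (U (-s) (u s)))
      (Complex.I • U (-t) (F (u t))) (Icc (-T) T) t := fun t ht => by
    rw [← hi]
    exact (hasDerivWithinAt_integral_Icc h0 hcont ht).const_add _
  have hKU : ∀ (t : ℝ) (x : X),
      HasDerivAt (fun s => K (U (-s) x)) (Complex.I • U (-t) x) t := fun t x => by
    have := (h.hasDerivAt (-t) x).scomp t (hasDerivAt_neg t)
    simpa using! this
  constructor
  · intro hd t ht
    -- `U(-t)u(t)` itself is not known to be differentiable, but `K² U(-t)u(t)` is.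
    apply hK
    apply hK
    refine eqOn_of_hasDerivWithinAt_Icc (f := fun t => K (K (U (-t) (u t))))
      (g := fun t => K (K (u 0 + ∫ s in (0 : ℝ)..t, interaction U F s (U (-s) (u s)))))
      (f' := fun t => K (K (Complex.I • U (-t) (F (u t))))) h0 (fun t ht => ?_)
      (fun t ht => ?_) ?_ ht
    · let A : ℝ → X →L[ℝ] X := fun t => (K.comp (U (-t))).restrictScalars ℝ
      have hA : ∀ t, ‖A t‖ ≤ ‖K‖ * C := fun t => by
        rw [ContinuousLinearMap.norm_restrictScalars]
        exact (ContinuousLinearMap.opNorm_comp_le _ _).trans (by gcongr; exact hC _)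
      have := hasDerivWithinAt_clm_apply hA
        (K.continuous.comp ((h.continuous_apply _).comp continuous_neg)).continuousAt
        (hd t ht) (hKU t (K (u t))).hasDerivWithinAt
      have e : ∀ s, A s (K (u s)) = K (K (U (-s) (u s))) := fun s => by
        change K (U (-s) (K (u s))) = _
        simp only [h.commute]
      have e2 : Complex.I • U (-t) (K (u t)) + A t (-Complex.I • (u t - K (F (u t)))) =
          K (K (Complex.I • U (-t) (F (u t)))) := by
        change _ + K (U (-t) (-Complex.I • (u t - K (F (u t))))) = _
        simp only [map_smul, map_sub, map_neg, h.commute, neg_smul, smul_sub]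
        abel
      rw [e2] at this
      simpa only [e] using this
    · exact ((K.comp K).restrictScalars ℝ).hasFDerivAt.comp_hasDerivWithinAt t (hg t ht)
    · simp [h.zero_apply]
  · intro he t ht
    let v : ℝ → X := fun t => u 0 + ∫ s in (0 : ℝ)..t, interaction U F s (U (-s) (u s))
    have hv : ∀ t ∈ Icc (-T) T, U t (v t) = u t := fun t ht => by
      change U t (u 0 + _) = _
      rw [← he t ht, h.apply_neg_apply]
    let A : ℝ → X →L[ℝ] X := fun t => (K.comp (U t)).restrictScalars ℝ
    have hA : ∀ t, ‖A t‖ ≤ ‖K‖ * C := fun t => by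
      rw [ContinuousLinearMap.norm_restrictScalars]
      exact (ContinuousLinearMap.opNorm_comp_le _ _).trans (by gcongr; exact hC _)
    have := hasDerivWithinAt_clm_apply hA
      (K.continuous.comp (h.continuous_apply _)).continuousAt
      (hg t ht) (h.hasDerivAt t (v t)).hasDerivWithinAt
    have e2 : -Complex.I • U t (v t) + A t (Complex.I • U (-t) (F (u t))) =
        -Complex.I • (u t - K (F (u t))) := by
      change _ + K (U t (Complex.I • U (-t) (F (u t)))) = _
      rw [hv t ht, map_smul, map_smul, h.apply_neg_apply, smul_sub]
      simp only [neg_smul]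
      abel
    rw [e2] at this
    refine this.congr (fun s hs => ?_) ?_
    · change _ = K (U s (v s))
      rw [hv s hs]
    · change _ = K (U t (v t))
      rw [hv t ht]

end

/-! ### Ordinary differential equations with a merely continuous time dependence -/

section ODE

variable {X : Type*} [NormedAddCommGroup X]

/-- `f t` is Lipschitz on every ball, uniformly in `t`. -/
def LipschitzOnBalls {ι : Type*} (f : ι → X → X) : Prop :=
  ∀ R : ℝ, ∃ L : NNReal, ∀ t, LipschitzOnWith L (f t) (Metric.closedBall 0 R)

variable {f : ℝ → X → X} {T : ℝ} (hT : 0 < T)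

theorem continuous_comp_IccExtend (hf : Continuous fun p : ℝ × X => f p.1 p.2)
    (v : C(Icc (-T) T, X)) : Continuous fun s => f s (IccExtend (neg_le_self hT.le) v s) :=
  hf.comp (continuous_id.prodMk v.continuous.Icc_extend')

variable [NormedSpace ℝ X]

/-- `v` solves `v' = f(t, v)`, `v(0) = x` on `[-T,T]`, in integral form. -/
def IsIntegralSolution (f : ℝ → X → X) {T : ℝ} (hT : 0 < T) (x : X) (v : C(Icc (-T) T, X)) : Prop :=
  ∀ t : Icc (-T) T, v t =
    x + ∫ s in (0 : ℝ)..t, f s (IccExtend (neg_le_self hT.le) v s)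

variable [CompleteSpace X]

/-- The integral equation is equivalent to the differential equation. -/
theorem isIntegralSolution_iff (hf : Continuous fun p : ℝ × X => f p.1 p.2) (x : X)
    (v : C(Icc (-T) T, X)) : IsIntegralSolution f hT x v ↔
      IccExtend (neg_le_self hT.le) v 0 = x ∧ ∀ t ∈ Icc (-T) T,
        HasDerivWithinAt (IccExtend (neg_le_self hT.le) v)
          (f t (IccExtend (neg_le_self hT.le) v t)) (Icc (-T) T) t := by
  have h0 : (0 : ℝ) ∈ Icc (-T) T := ⟨by linarith, hT.le⟩
  have hc := continuous_comp_IccExtend hT hf v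
  have hg : ∀ t ∈ Icc (-T) T, HasDerivWithinAt
      (fun t => x + ∫ s in (0 : ℝ)..t, f s (IccExtend (neg_le_self hT.le) v s))
      (f t (IccExtend (neg_le_self hT.le) v t)) (Icc (-T) T) t := fun t ht =>
    (hasDerivWithinAt_integral_Icc h0 hc.continuousOn ht).const_add _
  have hext : ∀ t (ht : t ∈ Icc (-T) T), IccExtend (neg_le_self hT.le) v t = v ⟨t, ht⟩ :=
    fun t ht => IccExtend_of_mem _ _ ht
  constructor
  · intro h
    have h' : EqOn (IccExtend (neg_le_self hT.le) v)
        (fun t => x + ∫ s in (0 : ℝ)..t, f s (IccExtend (neg_le_self hT.le) v s))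
        (Icc (-T) T) := fun t ht => by
      rw [hext t ht]
      exact h ⟨t, ht⟩
    exact ⟨by simpa using h' h0, fun t ht => (hg t ht).congr h' (h' ht)⟩
  · rintro ⟨hx, hd⟩ t
    rw [← IccExtend_val (neg_le_self hT.le) v t]
    exact eqOn_of_hasDerivWithinAt_Icc h0 hd hg (by simpa using hx) t.2

theorem IsIntegralSolution.unique (hf : Continuous fun p : ℝ × X => f p.1 p.2)
    (hl : LipschitzOnBalls f) {x : X} {v w : C(Icc (-T) T, X)}
    (hv : IsIntegralSolution f hT x v) (hw : IsIntegralSolution f hT x w) : v = w := by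
  rw [isIntegralSolution_iff hT hf] at hv hw
  obtain ⟨L, hL⟩ := hl (max ‖v‖ ‖w‖)
  have hb : ∀ z : C(Icc (-T) T, X), ‖z‖ ≤ max ‖v‖ ‖w‖ → ∀ t ∈ Ioo (-T) T,
      IccExtend (neg_le_self hT.le) z t ∈ Metric.closedBall (0 : X) (max ‖v‖ ‖w‖) :=
    fun z hz t ht => by
      rw [mem_closedBall_zero_iff, IccExtend_of_mem _ _ (Ioo_subset_Icc_self ht)]
      exact (z.norm_coe_le_norm _).trans hz
  have hd : ∀ z : C(Icc (-T) T, X), (∀ t ∈ Icc (-T) T,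
      HasDerivWithinAt (IccExtend (neg_le_self hT.le) z)
          (f t (IccExtend (neg_le_self hT.le) z t)) (Icc (-T) T) t) → ∀ t ∈ Ioo (-T) T,
      HasDerivAt (IccExtend (neg_le_self hT.le) z) (f t (IccExtend (neg_le_self hT.le) z t)) t :=
    fun z hz t ht => (hz t (Ioo_subset_Icc_self ht)).hasDerivAt (Icc_mem_nhds ht.1 ht.2)
  have := ODE_solution_unique_of_mem_Icc (v := f) (s := fun _ => Metric.closedBall 0 (max ‖v‖ ‖w‖))
    (t₀ := 0) (fun t _ => hL t) ⟨neg_lt_zero.2 hT, hT⟩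
    v.continuous.Icc_extend'.continuousOn (hd v hv.2) (hb v (le_max_left _ _))
    w.continuous.Icc_extend'.continuousOn (hd w hw.2) (hb w (le_max_right _ _))
    (hv.1.trans hw.1.symm)
  ext t
  have ht := this t.2
  rwa [IccExtend_val, IccExtend_val] at ht

theorem exists_isIntegralSolution (hf : Continuous fun p : ℝ × X => f p.1 p.2)
    (hl : LipschitzOnBalls f) (x : X) :
    ∃ (T : ℝ) (hT : 0 < T) (v : C(Icc (-T) T, X)), IsIntegralSolution f hT x v := by
  obtain ⟨L, hL⟩ := hl (‖x‖ + 1)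
  have hsub : Metric.closedBall x 1 ⊆ Metric.closedBall 0 (‖x‖ + 1) :=
    Metric.closedBall_subset_closedBall' (by rw [dist_zero_right, add_comm])
  obtain ⟨M, hM⟩ := (isCompact_Icc (a := (-1 : ℝ)) (b := 1)).exists_bound_of_continuousOn
    (hf.comp (continuous_id.prodMk continuous_const : Continuous fun t : ℝ => (t, x))).continuousOn
  have hM0 : 0 ≤ M := (norm_nonneg _).trans (hM 0 (by simp))
  let B : NNReal := ⟨M, hM0⟩ + L
  have hB : ∀ t ∈ Icc (-1 : ℝ) 1, ∀ y ∈ Metric.closedBall x 1, ‖f t y‖ ≤ B := by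
    intro t ht y hy
    have h1 := (hL t).dist_le_mul y (hsub hy) x (hsub (Metric.mem_closedBall_self zero_le_one))
    have h2 : dist (f t y) (f t x) ≤ L :=
      h1.trans (mul_le_of_le_one_right L.2 hy)
    have h3 : ‖f t x‖ ≤ M := hM t ht
    rw [dist_eq_norm] at h2
    calc ‖f t y‖ = ‖f t x + (f t y - f t x)‖ := by rw [add_sub_cancel]
      _ ≤ M + L := (norm_add_le _ _).trans (add_le_add h3 h2)
  -- On `[-T,T]` a solution moves by at most `B T ≤ 1`, hence stays in `closedBall x 1`.
  let T : ℝ := min 1 (1 / (B + 1))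
  have hT : 0 < T := lt_min one_pos (by positivity)
  have hT1 : T ≤ 1 := min_le_left _ _
  have hTB : B * T ≤ 1 := by
    have : T ≤ 1 / (B + 1) := min_le_right _ _
    rw [le_div_iff₀ (by positivity)] at this
    nlinarith
  have hpl : IsPicardLindelof f (tmin := -T) (tmax := T) ⟨0, neg_nonpos.2 hT.le, hT.le⟩ x 1 0 B L :=
    { lipschitzOnWith := fun t _ => (hL t).mono hsub
      continuousOn := fun y _ => (hf.comp (continuous_id.prodMk continuous_const)).continuousOn
      norm_le := fun t ht => hB t ⟨by linarith [ht.1], ht.2.trans hT1⟩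
      mul_max_le := by simpa using hTB }
  obtain ⟨α, h0, hα⟩ := hpl.exists_eq_forall_mem_Icc_hasDerivWithinAt₀
  have hc : ContinuousOn α (Icc (-T) T) := fun t ht => (hα t ht).continuousWithinAt
  let v : C(Icc (-T) T, X) := ⟨fun t => α t, continuousOn_iff_continuous_domRestrict.1 hc⟩
  have hv : EqOn (IccExtend (neg_le_self hT.le) v) α (Icc (-T) T) := fun t ht =>
    IccExtend_of_mem _ _ ht
  refine ⟨T, hT, v, (isIntegralSolution_iff hT hf x v).2 ⟨?_, fun t ht => ?_⟩⟩
  · rw [hv ⟨by linarith, hT.le⟩, ← h0]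
  · rw [hv ht]
    exact (hα t ht).congr hv (hv ht)

end ODE

/-! ### Volterra operators and smooth dependence on the data -/

section Volterra

variable {X : Type*} [NormedAddCommGroup X] [NormedSpace ℝ X] {f : ℝ → X → X} {T : ℝ} (hT : 0 < T)

/-- The operator `g ↦ ∫₀ᵗ g` on `C([-T,T]; X)`. -/
def integralL : C(Icc (-T) T, X) →L[ℝ] C(Icc (-T) T, X) :=
  LinearMap.mkContinuous
    { toFun := fun g => ⟨fun t => ∫ s in (0 : ℝ)..t, IccExtend (neg_le_self hT.le) g s,
        (intervalIntegral.continuous_primitive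
          (fun _ _ => g.continuous.Icc_extend'.intervalIntegrable _ _) 0).comp
          continuous_subtype_val⟩
      map_add' := fun g h => by
        ext t
        exact intervalIntegral.integral_add (g.continuous.Icc_extend'.intervalIntegrable _ _)
          (h.continuous.Icc_extend'.intervalIntegrable _ _)
      map_smul' := fun c g => by
        ext t
        exact intervalIntegral.integral_smul c _ } T fun g => by
    refine (ContinuousMap.norm_le _ (by positivity)).2 fun t => ?_
    change ‖∫ s in (0 : ℝ)..t, IccExtend (neg_le_self hT.le) g s‖ ≤ _
    refine (intervalIntegral.norm_integral_le_of_norm_le_const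
      (fun s _ => g.norm_coe_le_norm _)).trans ?_
    rw [sub_zero, mul_comm]
    gcongr
    exact abs_le.2 t.2

/-- The inclusion of `X` in `C([-T,T]; X)` as the constant functions. -/
def constL (T : ℝ) (X : Type*) [NormedAddCommGroup X] [NormedSpace ℝ X] :
    X →L[ℝ] C(Icc (-T) T, X) :=
  LinearMap.mkContinuous
    { toFun := fun x => ContinuousMap.const _ x
      map_add' := fun _ _ => rfl
      map_smul' := fun _ _ => rfl } 1 fun x => by
    rw [one_mul]
    exact (ContinuousMap.norm_le _ (norm_nonneg _)).2 fun _ => le_rfl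

/-- The iterates of the Volterra operator `∫₀ᵗ A` decay factorially. -/
theorem norm_integralL_comp_pow_apply_le {A : C(Icc (-T) T, X) →L[ℝ] C(Icc (-T) T, X)} {C : ℝ}
    (hC : 0 ≤ C) (hA : ∀ h t, ‖A h t‖ ≤ C * ‖h t‖) (n : ℕ) (h : C(Icc (-T) T, X))
    (t : Icc (-T) T) :
    ‖((integralL hT).comp A ^ n) h t‖ ≤ (C * |(t : ℝ)|) ^ n / n.factorial * ‖h‖ := by
  induction n generalizing t with
  | zero => simpa using h.norm_coe_le_norm t
  | succ n ih =>
    rw [pow_succ', mul_apply_eq_comp]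
    set g := ((integralL hT).comp A ^ n) h
    change ‖∫ s in (0 : ℝ)..t, IccExtend (neg_le_self hT.le) (A g) s‖ ≤ _
    have h0 : (0 : ℝ) ∈ Icc (-T) T := ⟨by linarith, hT.le⟩
    have hb : ∀ s ∈ uIoc (0 : ℝ) t, ‖IccExtend (neg_le_self hT.le) (A g) s‖ ≤
        C ^ (n + 1) / n.factorial * ‖h‖ * |s - 0| ^ n := by
      intro s hs
      have hs' : s ∈ Icc (-T) T := uIcc_subset_Icc h0 t.2 (uIoc_subset_uIcc hs)
      rw [IccExtend_of_mem _ _ hs']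
      refine (hA g _).trans ((mul_le_mul_of_nonneg_left (ih ⟨s, hs'⟩) hC).trans (le_of_eq ?_))
      rw [sub_zero]
      ring
    refine intervalIntegral.norm_integral_le_integral_norm_uIoc.trans ?_
    refine (setIntegral_mono_on ?_ ?_ measurableSet_uIoc hb).trans ?_
    · exact (intervalIntegrable_iff.1
        ((A g).continuous.Icc_extend'.norm.intervalIntegrable 0 (t : ℝ)))
    · exact intervalIntegrable_iff.1
        (Continuous.intervalIntegrable (by fun_prop) 0 (t : ℝ))
    · rw [integral_const_mul, integral_pow_abs_sub_uIoc, sub_zero, Nat.factorial_succ]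
      apply le_of_eq
      push_cast
      field_simp
      ring

/-- `1 - ∫₀ᵗ A` is invertible if `A` is local in time: the Volterra operator `∫₀ᵗ A` is
quasinilpotent. -/
theorem isUnit_one_sub_integralL_comp [CompleteSpace X]
    {A : C(Icc (-T) T, X) →L[ℝ] C(Icc (-T) T, X)} {C : ℝ}
    (hC : 0 ≤ C) (hA : ∀ h t, ‖A h t‖ ≤ C * ‖h t‖) : IsUnit (1 - (integralL hT).comp A) := by
  obtain ⟨n, hn⟩ := ((FloorSemiring.tendsto_pow_div_factorial_atTop (C * T)).eventually
    (gt_mem_nhds one_pos)).exists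
  set L := (integralL hT).comp A
  have hL : ‖L ^ n‖ < 1 := by
    refine lt_of_le_of_lt (ContinuousLinearMap.opNorm_le_bound _ (by positivity) fun h => ?_) hn
    refine (ContinuousMap.norm_le _ (by positivity)).2 fun t => ?_
    refine (norm_integralL_comp_pow_apply_le hT hC hA n h t).trans ?_
    gcongr
    exact abs_le.2 t.2
  have h1 : IsUnit (1 - L ^ n) := by
    exact isUnit_one_sub_of_norm_lt_one (R := C(Icc (-T) T, X) →L[ℝ] C(Icc (-T) T, X)) hL
  rw [← mul_neg_geom_sum] at h1
  refine ((Commute.isUnit_mul_iff ?_).1 h1).1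
  exact (Commute.one_left _).sub_left (Commute.sum_right _ _ _ fun i _ => Commute.self_pow L i)

/-- The derivative of a superposition operator `v ↦ f(·, v(·))` is local in time: the difference
quotients are, with the Lipschitz constant of `f` on a ball that contains the values of `v`. -/
theorem exists_norm_fderiv_apply_le (hl : LipschitzOnBalls f)
    {N : C(Icc (-T) T, X) → C(Icc (-T) T, X)} (hN : ∀ v t, N v t = f t (v t))
    {v : C(Icc (-T) T, X)} (hd : DifferentiableAt ℝ N v) :
    ∃ C, 0 ≤ C ∧ ∀ h t, ‖fderiv ℝ N v h t‖ ≤ C * ‖h t‖ := by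
  obtain ⟨L, hL⟩ := hl (‖v‖ + 1)
  refine ⟨L, L.2, fun h t => ?_⟩
  have h1 : HasDerivAt (fun r : ℝ => N (v + r • h)) (fderiv ℝ N v h) 0 := by
    have h2 : HasDerivAt (fun r : ℝ => v + r • h) h 0 := by
      simpa using ((hasDerivAt_id (0 : ℝ)).smul_const h).const_add v
    have h3 : HasFDerivAt N (fderiv ℝ N v) (v + (0 : ℝ) • h) := by
      simpa using hd.hasFDerivAt
    exact h3.comp_hasDerivAt 0 h2
  have h4 := (ContinuousMap.evalCLM ℝ t).hasFDerivAt.comp_hasDerivAt 0 h1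
  have h5 := h4.le_of_lip' (C := L * ‖h t‖) (by positivity) (by
    have hs : ∀ᶠ r : ℝ in nhds 0, ‖r • h‖ < 1 := by
      have : Continuous fun r : ℝ => ‖r • h‖ := by fun_prop
      exact (this.tendsto 0).eventually (gt_mem_nhds (by simp))
    filter_upwards [hs] with r hr
    have hb : ∀ w : C(Icc (-T) T, X), ‖w‖ ≤ ‖v‖ + 1 → w t ∈ Metric.closedBall 0 (‖v‖ + 1) :=
      fun w hw => mem_closedBall_zero_iff.2 ((w.norm_coe_le_norm t).trans hw)
    have := (hL t).dist_le_mul _ (hb (v + r • h) ((norm_add_le _ _).trans (by gcongr))) _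
      (hb v (by linarith))
    rw [dist_eq_norm, dist_eq_norm] at this
    simp only [Function.comp_apply, ContinuousMap.evalCLM_apply, zero_smul, add_zero, sub_zero, hN]
    refine this.trans (le_of_eq ?_)
    simp [norm_smul]
    ring)
  exact h5

/-- Smooth dependence on the data. The integral equation `v - x - ∫₀ᵗ f(s, v(s)) ds = 0` is solved
for `v` by the implicit function theorem. -/
theorem IsIntegralSolution.exists_contDiffAt [CompleteSpace X] (hl : LipschitzOnBalls f)
    {N : C(Icc (-T) T, X) → C(Icc (-T) T, X)} (hN : ∀ v t, N v t = f t (v t))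
    (hNs : ContDiff ℝ ∞ N) {x₀ : X} {v₀ : C(Icc (-T) T, X)}
    (h₀ : IsIntegralSolution f hT x₀ v₀) :
    ∃ ψ : X → C(Icc (-T) T, X), ContDiffAt ℝ ∞ ψ x₀ ∧
      ∀ᶠ x in nhds x₀, IsIntegralSolution f hT x (ψ x) := by
  let Ψ : X × C(Icc (-T) T, X) → C(Icc (-T) T, X) := fun p =>
    p.2 - constL T X p.1 - integralL hT (N p.2)
  have hΨ : ContDiff ℝ ∞ Ψ :=
    (contDiff_snd.sub ((constL T X).contDiff.comp contDiff_fst)).sub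
      ((integralL hT).contDiff.comp (hNs.comp contDiff_snd))
  have hzero : ∀ x v, Ψ (x, v) = 0 ↔ IsIntegralSolution f hT x v := by
    intro x v
    change v - constL T X x - integralL hT (N v) = 0 ↔ _
    rw [sub_sub, sub_eq_zero, ContinuousMap.ext_iff]
    refine forall_congr' fun t => ?_
    have : ∫ s in (0 : ℝ)..t, IccExtend (neg_le_self hT.le) (N v) s =
        ∫ s in (0 : ℝ)..t, f s (IccExtend (neg_le_self hT.le) v s) := by
      refine intervalIntegral.integral_congr fun s hs => ?_
      have hs' : s ∈ Icc (-T) T := uIcc_subset_Icc ⟨by linarith, hT.le⟩ t.2 hs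
      change IccExtend _ (N v) s = f s (IccExtend _ v s)
      rw [IccExtend_of_mem _ _ hs', IccExtend_of_mem _ _ hs', hN]
    rw [← this]
    rfl
  have hNd : DifferentiableAt ℝ N v₀ := hNs.differentiable (by simp) v₀
  have hd : fderiv ℝ Ψ (x₀, v₀) ∘L .inr ℝ X C(Icc (-T) T, X) =
      1 - (integralL hT).comp (fderiv ℝ N v₀) := by
    have h1 : HasFDerivAt (fun v => Ψ (x₀, v)) (1 - (integralL hT).comp (fderiv ℝ N v₀)) v₀ := by
      have h3 : HasFDerivAt (fun v => integralL hT (N v))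
          ((integralL hT).comp (fderiv ℝ N v₀)) v₀ := by
        have h4 : HasFDerivAt (integralL hT : C(Icc (-T) T, X) → _) (integralL hT) (N v₀) :=
          ContinuousLinearMap.hasFDerivAt _
        exact h4.comp v₀ hNd.hasFDerivAt
      exact ((hasFDerivAt_id v₀).sub_const (constL T X x₀)).sub h3
    have h2 : HasFDerivAt (fun v => Ψ (x₀, v))
        (fderiv ℝ Ψ (x₀, v₀) ∘L .inr ℝ X C(Icc (-T) T, X)) v₀ :=
      ((hΨ.differentiable (by simp) (x₀, v₀)).hasFDerivAt).comp v₀ (hasFDerivAt_prodMk_right x₀ v₀)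
    exact h2.unique h1
  have hinv : (fderiv ℝ Ψ (x₀, v₀) ∘L .inr ℝ X C(Icc (-T) T, X)).IsInvertible := by
    obtain ⟨C, hC, hb⟩ := exists_norm_fderiv_apply_le hl hN hNd
    obtain ⟨u, hu⟩ := isUnit_one_sub_integralL_comp hT hC hb
    rw [hd, ← hu]
    exact ⟨ContinuousLinearEquiv.ofUnit u, rfl⟩
  have hcd : ContDiffAt ℝ ∞ Ψ (x₀, v₀) := hΨ.contDiffAt
  refine ⟨hcd.implicitFunction (by simp) hinv, hcd.contDiffAt_implicitFunction (by simp) hinv, ?_⟩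
  filter_upwards [hcd.eventually_apply_implicitFunction (by simp) hinv] with x hx
  rw [← hzero, hx]
  exact (hzero _ _).2 h₀

end Volterra

/-! ### Superposition operators -/

section Superposition

variable {ι : Type*} [TopologicalSpace ι] [CompactSpace ι]
  {X : Type*} [NormedAddCommGroup X] [NormedSpace ℝ X]
  {Y : Type*} [NormedAddCommGroup Y] [NormedSpace ℝ Y]
  {Z : Type*} [NormedAddCommGroup Z] [NormedSpace ℝ Z]

/-- `f` induces a smooth superposition operator `v ↦ (t ↦ f t (v t))` between spaces of continuous
functions. -/
def HasSmoothSuperposition (f : ι → X → Y) : Prop :=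
  ∃ N : C(ι, X) → C(ι, Y), ContDiff ℝ ∞ N ∧ ∀ v t, N v t = f t (v t)

theorem HasSmoothSuperposition.comp {g : ι → Y → Z} {f : ι → X → Y}
    (hg : HasSmoothSuperposition g) (hf : HasSmoothSuperposition f) :
    HasSmoothSuperposition fun t x => g t (f t x) := by
  obtain ⟨M, hM, hMg⟩ := hg
  obtain ⟨N, hN, hNf⟩ := hf
  exact ⟨M ∘ N, hM.comp hN, fun v t => by rw [Function.comp_apply, hMg, hNf]⟩

theorem HasSmoothSuperposition.add {f g : ι → X → Y}
    (hf : HasSmoothSuperposition f) (hg : HasSmoothSuperposition g) :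
    HasSmoothSuperposition fun t x => f t x + g t x := by
  obtain ⟨M, hM, hMf⟩ := hf
  obtain ⟨N, hN, hNg⟩ := hg
  exact ⟨fun v => M v + N v, hM.add hN, fun v t => by
    rw [ContinuousMap.add_apply, hMf, hNg]⟩

/-- A bounded, strongly continuous family of linear operators acts linearly, hence smoothly. -/
theorem hasSmoothSuperposition_family {A : ι → X →L[ℝ] Y} {C : ℝ} (hC : ∀ t, ‖A t‖ ≤ C)
    (hA : Continuous fun p : ι × X => A p.1 p.2) : HasSmoothSuperposition fun t x => A t x := by
  let L : C(ι, X) →L[ℝ] C(ι, Y) := LinearMap.mkContinuous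
    { toFun := fun v => ⟨fun t => A t (v t), hA.comp (continuous_id.prodMk v.continuous)⟩
      map_add' := fun v w => ContinuousMap.ext fun t => (A t).map_add (v t) (w t)
      map_smul' := fun c v => ContinuousMap.ext fun t => (A t).map_smul c (v t) } |C| fun v => by
    refine (ContinuousMap.norm_le _ (by positivity)).2 fun t => ?_
    exact ((A t).le_of_opNorm_le ((hC t).trans (le_abs_self C)) _).trans
      (mul_le_mul_of_nonneg_left (v.norm_coe_le_norm t) (abs_nonneg C))
  exact ⟨L, L.contDiff, fun _ _ => rfl⟩

theorem hasSmoothSuperposition_clm (A : X →L[ℝ] Y) :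
    HasSmoothSuperposition fun (_ : ι) x => A x :=
  hasSmoothSuperposition_family (fun _ => le_rfl) (A.continuous.comp continuous_snd)

theorem HasSmoothSuperposition.bilin {W : Type*} [NormedAddCommGroup W] [NormedSpace ℝ W]
    (B : X →L[ℝ] Y →L[ℝ] Z) {f : ι → W → X} {g : ι → W → Y}
    (hf : HasSmoothSuperposition f) (hg : HasSmoothSuperposition g) :
    HasSmoothSuperposition fun t x => B (f t x) (g t x) := by
  let L : C(ι, X) →L[ℝ] C(ι, Y) →L[ℝ] C(ι, Z) := LinearMap.mkContinuous₂
    (LinearMap.mk₂ ℝ (fun v w => ⟨fun t => B (v t) (w t),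
        (B.continuous.comp v.continuous).clm_apply w.continuous⟩)
      (fun v v' w => ContinuousMap.ext fun t => B.map_add₂ (v t) (v' t) (w t))
      (fun c v w => ContinuousMap.ext fun t => B.map_smul₂ c (v t) (w t))
      (fun v w w' => ContinuousMap.ext fun t => (B (v t)).map_add (w t) (w' t))
      (fun c v w => ContinuousMap.ext fun t => (B (v t)).map_smul c (w t))) ‖B‖ fun v w => by
    refine (ContinuousMap.norm_le _ (by positivity)).2 fun t => ?_
    refine (B.le_opNorm₂ (v t) (w t)).trans ?_
    gcongr
    · exact v.norm_coe_le_norm t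
    · exact w.norm_coe_le_norm t
  obtain ⟨M, hM, hMf⟩ := hf
  obtain ⟨N, hN, hNg⟩ := hg
  refine ⟨fun v => L (M v) (N v), (L.contDiff.comp hM).clm_apply hN, fun v t => ?_⟩
  beta_reduce
  rw [← hMf, ← hNg]
  rfl

end Superposition

section Lipschitz

variable {ι : Type*} {X : Type*} [NormedAddCommGroup X] {Y : Type*} [NormedAddCommGroup Y]
  {Z : Type*} [NormedAddCommGroup Z]

/-- `f t` is bounded and Lipschitz on every ball, uniformly in `t`. -/
def BoundedLipschitzOnBalls (f : ι → X → Y) : Prop :=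
  ∀ R : ℝ, ∃ C : ℝ, 0 ≤ C ∧ ∀ t, (∀ x, ‖x‖ ≤ R → ‖f t x‖ ≤ C) ∧
    ∀ x y, ‖x‖ ≤ R → ‖y‖ ≤ R → ‖f t x - f t y‖ ≤ C * ‖x - y‖

theorem BoundedLipschitzOnBalls.lipschitzOnBalls {f : ι → X → X}
    (hf : BoundedLipschitzOnBalls f) : LipschitzOnBalls f := fun R => by
  obtain ⟨C, hC, h⟩ := hf R
  refine ⟨⟨C, hC⟩, fun t => LipschitzOnWith.of_dist_le_mul fun x hx y hy => ?_⟩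
  rw [dist_eq_norm, dist_eq_norm]
  exact (h t).2 x y (mem_closedBall_zero_iff.1 hx) (mem_closedBall_zero_iff.1 hy)

theorem BoundedLipschitzOnBalls.comp {g : ι → Y → Z} {f : ι → X → Y}
    (hg : BoundedLipschitzOnBalls g) (hf : BoundedLipschitzOnBalls f) :
    BoundedLipschitzOnBalls fun t x => g t (f t x) := fun R => by
  obtain ⟨C, hC, hf⟩ := hf R
  obtain ⟨D, hD, hg⟩ := hg C
  refine ⟨max D (D * C), le_max_of_le_left hD, fun t => ⟨fun x hx => ?_, fun x y hx hy => ?_⟩⟩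
  · exact ((hg t).1 _ ((hf t).1 x hx)).trans (le_max_left _ _)
  · refine ((hg t).2 _ _ ((hf t).1 x hx) ((hf t).1 y hy)).trans ?_
    refine (mul_le_mul_of_nonneg_left ((hf t).2 x y hx hy) hD).trans ?_
    rw [← mul_assoc]
    gcongr
    exact le_max_right _ _

theorem BoundedLipschitzOnBalls.add {f g : ι → X → Y}
    (hf : BoundedLipschitzOnBalls f) (hg : BoundedLipschitzOnBalls g) :
    BoundedLipschitzOnBalls fun t x => f t x + g t x := fun R => by
  obtain ⟨C, hC, hf⟩ := hf R
  obtain ⟨D, hD, hg⟩ := hg R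
  refine ⟨C + D, add_nonneg hC hD, fun t => ⟨fun x hx => ?_, fun x y hx hy => ?_⟩⟩
  · exact norm_add_le_of_le ((hf t).1 x hx) ((hg t).1 x hx)
  · rw [add_sub_add_comm, add_mul]
    exact norm_add_le_of_le ((hf t).2 x y hx hy) ((hg t).2 x y hx hy)

variable [NormedSpace ℝ X] [NormedSpace ℝ Y] [NormedSpace ℝ Z]

theorem boundedLipschitzOnBalls_family {A : ι → X →L[ℝ] Y} {C : ℝ} (hC : ∀ t, ‖A t‖ ≤ C) :
    BoundedLipschitzOnBalls fun t x => A t x := fun R => by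
  refine ⟨max |C| (|C| * R), le_max_of_le_left (abs_nonneg C),
    fun t => ⟨fun x hx => ?_, fun x y _ _ => ?_⟩⟩
  · refine ((A t).le_of_opNorm_le ((hC t).trans (le_abs_self C)) x).trans ?_
    exact (mul_le_mul_of_nonneg_left hx (abs_nonneg C)).trans (le_max_right _ _)
  · rw [← map_sub]
    refine ((A t).le_of_opNorm_le ((hC t).trans (le_abs_self C)) _).trans ?_
    gcongr
    exact le_max_left _ _

theorem boundedLipschitzOnBalls_clm (A : X →L[ℝ] Y) :
    BoundedLipschitzOnBalls fun (_ : ι) x => A x :=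
  boundedLipschitzOnBalls_family fun _ => le_rfl

theorem BoundedLipschitzOnBalls.bilin {W : Type*} [NormedAddCommGroup W]
    (B : X →L[ℝ] Y →L[ℝ] Z) {f : ι → W → X} {g : ι → W → Y}
    (hf : BoundedLipschitzOnBalls f) (hg : BoundedLipschitzOnBalls g) :
    BoundedLipschitzOnBalls fun t x => B (f t x) (g t x) := fun R => by
  obtain ⟨C, hC, hf⟩ := hf R
  obtain ⟨D, hD, hg⟩ := hg R
  refine ⟨max (‖B‖ * C * D) (2 * ‖B‖ * C * D), le_max_of_le_left (by positivity),
    fun t => ⟨fun x hx => ?_, fun x y hx hy => ?_⟩⟩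
  · refine (B.le_opNorm₂ _ _).trans (le_max_of_le_left ?_)
    gcongr
    · exact (hf t).1 x hx
    · exact (hg t).1 x hx
  · have e : B (f t x) (g t x) - B (f t y) (g t y) =
        B (f t x - f t y) (g t x) + B (f t y) (g t x - g t y) := by
      rw [map_sub, map_sub, sub_apply, sub_add_sub_cancel]
    have h1 : ‖B (f t x - f t y) (g t x)‖ ≤ ‖B‖ * (C * ‖x - y‖) * D := by
      refine (B.le_opNorm₂ _ _).trans ?_
      gcongr
      · exact (hf t).2 x y hx hy
      · exact (hg t).1 x hx
    have h2 : ‖B (f t y) (g t x - g t y)‖ ≤ ‖B‖ * C * (D * ‖x - y‖) := by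
      refine (B.le_opNorm₂ _ _).trans ?_
      gcongr
      · exact (hf t).1 y hy
      · exact (hg t).2 x y hx hy
    rw [e]
    refine (norm_add_le_of_le h1 h2).trans ?_
    refine le_trans (le_of_eq ?_) (mul_le_mul_of_nonneg_right (le_max_right _ _) (norm_nonneg _))
    ring

end Lipschitz

/-! ### Products and conjugation in `H¹(ℝ)` -/

/-- The element `(f, g)` of `H¹(ℝ)`, where `g` is the weak derivative of `f`. -/
def H1.mk (f g : L2) (h : HasWeakDeriv f g) : H1 := ⟨WithLp.toLp 2 (f, g), h⟩

theorem H1.toL2_mk (f g : L2) (h : HasWeakDeriv f g) : (H1.mk f g h).toL2 = f := rfl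

theorem H1.weakDeriv_mk (f g : L2) (h : HasWeakDeriv f g) : (H1.mk f g h).weakDeriv = g := rfl

theorem H1.norm_sq (u : H1) : ‖u‖ ^ 2 = ‖u.toL2‖ ^ 2 + ‖u.weakDeriv‖ ^ 2 :=
  WithLp.prod_norm_sq_eq_of_L2 u.1

theorem H1.inner_eq (u v : H1) :
    inner ℂ u v = inner ℂ u.toL2 v.toL2 + inner ℂ u.weakDeriv v.weakDeriv :=
  WithLp.prod_inner_apply u.1 v.1

/-- `H¹(ℝ)` is complete, since being a weak derivative is a closed condition on pairs in
`L² × L²`. -/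
instance : CompleteSpace H1 := by
  have hc : IsClosed (sobolevSubmodule : Set (WithLp 2 (L2 × L2))) := by
    have e : (sobolevSubmodule : Set (WithLp 2 (L2 × L2))) =
        ⋂ (φ : ℝ → ℝ) (_ : ContDiff ℝ ∞ φ) (_ : HasCompactSupport φ),
          {p | ∫ x, deriv φ x • p.fst x = -∫ x, φ x • p.snd x} := by
      ext p
      simp only [mem_iInter]
      rfl
    rw [e]
    refine isClosed_iInter fun φ => isClosed_iInter fun hφ => isClosed_iInter fun hc => ?_
    have hcont : ∀ ψ : ℝ → ℝ, Continuous ψ → HasCompactSupport ψ →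
        Continuous fun f : L2 => ∫ x, ψ x • f x := by
      intro ψ hψ hψc
      have hm : MemLp (fun x => (ψ x : ℂ)) 2 volume :=
        (Complex.continuous_ofReal.comp hψ).memLp_of_hasCompactSupport
          (hψc.comp_left (g := Complex.ofReal) rfl)
      have e : (fun f : L2 => ∫ x, ψ x • f x) = fun f => pairing (hm.toLp _) f := by
        funext f
        rw [pairing_apply]
        refine integral_congr_ae ?_
        filter_upwards [hm.coeFn_toLp] with x hx
        rw [hx, Complex.real_smul]
      rw [e]
      exact (pairing _).continuous
    exact isClosed_eq
      ((hcont _ (hφ.continuous_deriv (by simp)) hc.deriv).comp (WithLp.fstL 2 ℂ L2 L2).continuous)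
      ((hcont _ hφ.continuous hc).comp (WithLp.sndL 2 ℂ L2 L2).continuous).neg
  exact hc.completeSpace_coe

theorem H1.norm_toL2_le (u : H1) : ‖u.toL2‖ ≤ ‖u‖ := by
  nlinarith [u.norm_sq, sq_nonneg ‖u.weakDeriv‖, norm_nonneg u, norm_nonneg u.toL2]

theorem H1.norm_weakDeriv_le (u : H1) : ‖u.weakDeriv‖ ≤ ‖u‖ := by
  nlinarith [u.norm_sq, sq_nonneg ‖u.toL2‖, norm_nonneg u, norm_nonneg u.weakDeriv]

theorem H1.norm_le (u : H1) : ‖u‖ ≤ ‖u.toL2‖ + ‖u.weakDeriv‖ := by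
  have := mul_nonneg (norm_nonneg u.toL2) (norm_nonneg u.weakDeriv)
  refine (pow_le_pow_iff_left₀ (norm_nonneg u) (by positivity) two_ne_zero).1 ?_
  rw [u.norm_sq]
  nlinarith

theorem H1.norm_rep_le_norm (u : H1) (x : ℝ) : ‖u.rep x‖ ≤ 2 * ‖u‖ := by
  linarith [u.norm_rep_le x, u.norm_toL2_le, u.norm_weakDeriv_le]

/-- Weak derivatives are unique. -/
theorem H1.ext_toL2 {u v : H1} (h : u.toL2 = v.toL2) : u = v := by
  have hw : (u - v).weakDeriv = 0 := by
    rw [Lp.eq_zero_iff_ae_eq_zero]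
    refine ae_eq_zero_of_integral_contDiff_smul_eq_zero (u - v).weakDeriv.locallyIntegrable
      fun φ hφ hc => ?_
    have h1 := (u - v).hasWeakDeriv φ hφ hc
    have h0 : (u - v).toL2 = 0 := by rw [map_sub, h, sub_self]
    rw [h0, integral_congr_ae (g := fun _ => (0 : ℂ)), integral_zero] at h1
    · linear_combination h1
    · filter_upwards [Lp.coeFn_zero ℂ 2 (volume : Measure ℝ)] with x hx
      rw [hx, Pi.zero_apply, smul_zero]
  have h2 := (u - v).norm_sq
  rw [hw, map_sub, h, sub_self, norm_zero] at h2
  rw [← sub_eq_zero, ← norm_eq_zero]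
  simpa using h2

theorem H1.ext_rep {u v : H1} (h : u.rep = v.rep) : u = v :=
  H1.ext_toL2 (Lp.ext (u.rep_ae.trans (h ▸ v.rep_ae.symm)))

/-- The pointwise form of a weak derivative: `F` is a primitive of `g`. -/
theorem hasWeakDeriv_of_primitive {f g : L2} {F : ℝ → ℂ} (hF : f =ᵐ[volume] F)
    (hg : ∀ x, F x = F 0 + ∫ t in (0 : ℝ)..x, g t) : HasWeakDeriv f g := by
  intro φ hφ hc
  have hd : Continuous (deriv φ) := hφ.continuous_deriv (by simp)
  have hi := intervalIntegrable_of_locallyIntegrable g.locallyIntegrable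
  have e : ∫ x, deriv φ x • f x =
      ∫ x, (deriv φ x • F 0 + deriv φ x • ∫ t in (0 : ℝ)..x, g t) := by
    refine integral_congr_ae ?_
    filter_upwards [hF] with x hx
    rw [hx, hg, smul_add]
  have i1 : Integrable (deriv φ) := hd.integrable_of_hasCompactSupport hc.deriv
  have h0 : ∫ x, deriv φ x = 0 :=
    integral_eq_zero_of_hasDerivAt_of_integrable
      (fun x => (hφ.differentiable (by simp) x).hasDerivAt) i1
      (hφ.continuous.integrable_of_hasCompactSupport hc)
  have hcont : Continuous fun x => ∫ t in (0 : ℝ)..x, g t :=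
    intervalIntegral.continuous_primitive hi 0
  have i2 : Integrable fun x => deriv φ x • ∫ t in (0 : ℝ)..x, g t :=
    (hd.smul hcont).integrable_of_hasCompactSupport hc.deriv.smul_right
  rw [e, integral_add (i1.smul_const _) i2, integral_smul_const, h0, zero_smul, zero_add,
    integral_deriv_smul_primitive g.locallyIntegrable hφ hc]

theorem H1.memLp_rep_mul (u : H1) (f : L2) : MemLp (fun x => u.rep x * f x) 2 volume := by
  refine MemLp.of_le_mul (c := 2 * ‖u‖) (Lp.memLp f)
    (u.continuous_rep.aestronglyMeasurable.mul (Lp.memLp f).1) (.of_forall fun x => ?_)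
  rw [norm_mul]
  gcongr
  exact u.norm_rep_le_norm x

/-- Multiplication of a function in `L²(ℝ)` by a function in `H¹(ℝ) ⊆ L^∞(ℝ)`. -/
def H1.mulL2 : H1 →L[ℂ] L2 →L[ℂ] L2 :=
  LinearMap.mkContinuous₂
    (LinearMap.mk₂ ℂ (fun u f => (u.memLp_rep_mul f).toLp _)
      (fun u v f => by
        rw [← MemLp.toLp_add]
        exact MemLp.toLp_congr _ _ (.of_forall fun x => by
          simp only [Pi.add_apply, H1.rep_add, add_mul]))
      (fun c u f => by
        rw [← MemLp.toLp_const_smul]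
        exact MemLp.toLp_congr _ _ (.of_forall fun x => by
          simp only [Pi.smul_apply, H1.rep_smul, smul_eq_mul, mul_assoc]))
      (fun u f g => by
        rw [← MemLp.toLp_add]
        refine MemLp.toLp_congr _ _ ?_
        filter_upwards [Lp.coeFn_add f g] with x hx
        simp only [hx, Pi.add_apply, mul_add])
      (fun c u f => by
        rw [← MemLp.toLp_const_smul]
        refine MemLp.toLp_congr _ _ ?_
        filter_upwards [Lp.coeFn_smul c f] with x hx
        simp only [hx, Pi.smul_apply, smul_eq_mul]
        ring)) 2 fun u f => by
    refine Lp.norm_le_mul_norm_of_ae_le_mul ?_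
    filter_upwards [(u.memLp_rep_mul f).coeFn_toLp] with x hx
    rw [LinearMap.mk₂_apply, hx, norm_mul]
    gcongr
    exact u.norm_rep_le_norm x

theorem H1.mulL2_ae (u : H1) (f : L2) : H1.mulL2 u f =ᵐ[volume] fun x => u.rep x * f x :=
  (u.memLp_rep_mul f).coeFn_toLp

theorem H1.mulL2_toL2_ae (u v : H1) :
    H1.mulL2 u v.toL2 =ᵐ[volume] fun x => u.rep x * v.rep x := by
  filter_upwards [H1.mulL2_ae u v.toL2, v.rep_ae] with x h1 h2
  rw [h1, h2]

theorem H1.rep_eq_primitive (u : H1) (x : ℝ) :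
    u.rep 0 + ∫ t in (0 : ℝ)..x, u.weakDeriv t = u.rep x := by
  rw [← u.rep_sub_rep]
  ring

/-- Leibniz rule. -/
theorem H1.hasWeakDeriv_mul (u v : H1) : HasWeakDeriv (H1.mulL2 u v.toL2)
    (H1.mulL2 u v.weakDeriv + H1.mulL2 v u.weakDeriv) := by
  refine hasWeakDeriv_of_primitive (u.mulL2_toL2_ae v) fun x => ?_
  have h := integral_by_parts u.weakDeriv.locallyIntegrable v.weakDeriv.locallyIntegrable
    (u.rep 0) (v.rep 0) 0 x
  simp only [H1.rep_eq_primitive] at h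
  have e : ∫ t in (0 : ℝ)..x, (H1.mulL2 u v.weakDeriv + H1.mulL2 v u.weakDeriv : L2) t =
      ∫ t in (0 : ℝ)..x, (u.weakDeriv t * v.rep t + u.rep t * v.weakDeriv t) := by
    refine intervalIntegral.integral_congr_ae ?_
    filter_upwards [Lp.coeFn_add (H1.mulL2 u v.weakDeriv) (H1.mulL2 v u.weakDeriv),
      H1.mulL2_ae u v.weakDeriv, H1.mulL2_ae v u.weakDeriv] with t h1 h2 h3 _
    rw [h1, Pi.add_apply, h2, h3]
    ring
  rw [e, h]
  ring

/-- The product of two functions in `H¹(ℝ)`. -/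
def H1.mul : H1 →L[ℂ] H1 →L[ℂ] H1 :=
  LinearMap.mkContinuous₂
    (LinearMap.mk₂ ℂ (fun u v => H1.mk _ _ (u.hasWeakDeriv_mul v))
      (fun u v w => H1.ext_toL2 (by
        simp only [map_add, H1.toL2_mk, add_apply]))
      (fun c u w => H1.ext_toL2 (by
        simp only [map_smul, H1.toL2_mk, smul_apply]))
      (fun u v w => H1.ext_toL2 (by
        simp only [map_add, H1.toL2_mk]))
      (fun c u w => H1.ext_toL2 (by
        simp only [map_smul, H1.toL2_mk]))) (3 * ‖H1.mulL2‖) fun u v => by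
    rw [LinearMap.mk₂_apply]
    refine (H1.norm_le _).trans ?_
    rw [H1.toL2_mk, H1.weakDeriv_mk]
    have hb : ∀ (a : H1) (f : L2), ‖H1.mulL2 a f‖ ≤ ‖H1.mulL2‖ * ‖a‖ * ‖f‖ :=
      fun a f => H1.mulL2.le_opNorm₂ a f
    have h1 : ‖H1.mulL2 u v.toL2‖ ≤ ‖H1.mulL2‖ * ‖u‖ * ‖v‖ :=
      (hb _ _).trans (by gcongr; exact v.norm_toL2_le)
    have h2 : ‖H1.mulL2 u v.weakDeriv‖ ≤ ‖H1.mulL2‖ * ‖u‖ * ‖v‖ :=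
      (hb _ _).trans (by gcongr; exact v.norm_weakDeriv_le)
    have h3 : ‖H1.mulL2 v u.weakDeriv‖ ≤ ‖H1.mulL2‖ * ‖v‖ * ‖u‖ :=
      (hb _ _).trans (by gcongr; exact u.norm_weakDeriv_le)
    have h4 := norm_add_le (H1.mulL2 u v.weakDeriv) (H1.mulL2 v u.weakDeriv)
    nlinarith

theorem H1.rep_mul (u v : H1) (x : ℝ) : (H1.mul u v).rep x = u.rep x * v.rep x :=
  congrFun (H1.rep_eq_of_ae _ (u.continuous_rep.mul v.continuous_rep) (u.mulL2_toL2_ae v)) x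

theorem H1.hasWeakDeriv_star (u : H1) : HasWeakDeriv (star u.toL2) (star u.weakDeriv) := by
  intro φ hφ hc
  have h : ∀ (ψ : ℝ → ℝ) (f : L2), ∫ x, ψ x • (star f : L2) x =
      (starRingEnd ℂ) (∫ x, ψ x • f x) := fun ψ f => by
    rw [← integral_conj]
    refine integral_congr_ae ?_
    filter_upwards [Lp.coeFn_star f] with x hx
    rw [hx, Pi.star_apply]
    simp
  rw [h, h, u.hasWeakDeriv φ hφ hc, map_neg]

theorem L2.norm_star (f : L2) : ‖(star f : L2)‖ = ‖f‖ := by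
  refine le_antisymm (Lp.norm_le_norm_of_ae_le ?_) (Lp.norm_le_norm_of_ae_le ?_) <;>
  · filter_upwards [Lp.coeFn_star f] with x hx
    rw [hx, Pi.star_apply, _root_.norm_star]

theorem L2.star_add (f g : L2) : (star (f + g) : L2) = star f + star g := by
  refine Lp.ext ?_
  filter_upwards [Lp.coeFn_star (f + g), Lp.coeFn_add f g, Lp.coeFn_add (star f) (star g),
    Lp.coeFn_star f, Lp.coeFn_star g] with x h1 h2 h3 h4 h5
  rw [h1, h3, Pi.star_apply, h2, Pi.add_apply, Pi.add_apply, h4, h5, Pi.star_apply, Pi.star_apply,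
    StarAddMonoid.star_add]

theorem L2.star_smul (c : ℂ) (f : L2) : (star (c • f) : L2) = (starRingEnd ℂ) c • star f := by
  refine Lp.ext ?_
  filter_upwards [Lp.coeFn_star (c • f), Lp.coeFn_smul c f,
    Lp.coeFn_smul ((starRingEnd ℂ) c) (star f), Lp.coeFn_star f] with x h1 h2 h3 h4
  rw [h1, h3, Pi.star_apply, h2, Pi.smul_apply, Pi.smul_apply, h4, Pi.star_apply,
    StarModule.star_smul]
  rfl

theorem L2.inner_star (f g : L2) : inner ℂ (star f : L2) g = ∫ x, f x * g x := by
  rw [MeasureTheory.L2.inner_def]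
  refine integral_congr_ae ?_
  filter_upwards [Lp.coeFn_star f] with x hx
  rw [hx, Pi.star_apply, RCLike.inner_apply, RCLike.star_def, RCLike.conj_conj, mul_comm]

/-- Complex conjugation on `H¹(ℝ)`. -/
def H1.conj : H1 ≃ₗᵢ⋆[ℂ] H1 where
  toFun u := H1.mk _ _ u.hasWeakDeriv_star
  invFun u := H1.mk _ _ u.hasWeakDeriv_star
  left_inv u := H1.ext_toL2 (by rw [H1.toL2_mk, H1.toL2_mk, star_star])
  right_inv u := H1.ext_toL2 (by rw [H1.toL2_mk, H1.toL2_mk, star_star])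
  map_add' u v := H1.ext_toL2 (by simp only [map_add, H1.toL2_mk, L2.star_add])
  map_smul' c u := H1.ext_toL2 (by simp only [map_smul, H1.toL2_mk, L2.star_smul])
  norm_map' u := by
    refine (pow_left_inj₀ (norm_nonneg _) (norm_nonneg _) two_ne_zero).1 ?_
    rw [H1.norm_sq, H1.norm_sq u]
    change ‖(star u.toL2 : L2)‖ ^ 2 + ‖(star u.weakDeriv : L2)‖ ^ 2 = _
    rw [L2.norm_star, L2.norm_star]

theorem H1.toL2_conj (u : H1) : (H1.conj u).toL2 = star u.toL2 := rfl

theorem H1.weakDeriv_conj (u : H1) : (H1.conj u).weakDeriv = star u.weakDeriv := rfl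

theorem H1.rep_conj (u : H1) (x : ℝ) : (H1.conj u).rep x = star (u.rep x) := by
  refine congrFun (H1.rep_eq_of_ae _ u.continuous_rep.star ?_) x
  rw [H1.toL2_conj]
  filter_upwards [Lp.coeFn_star u.toL2, u.rep_ae] with y h1 h2
  rw [h1, Pi.star_apply, h2]

/-- Complex conjugation on `H¹(ℝ)`, as a real linear map. -/
def H1.conjL : H1 →L[ℝ] H1 :=
  LinearMap.mkContinuous
    { toFun := H1.conj
      map_add' := map_add H1.conj
      map_smul' := fun c u => by
        rw [RCLike.real_smul_eq_coe_smul (K := ℂ), map_smulₛₗ]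
        simp } 1 fun u => by
    rw [one_mul]
    exact (H1.conj.norm_map u).le

theorem H1.conjL_apply (u : H1) : H1.conjL u = H1.conj u := rfl

/-! ### The reflection of the real line -/

/-- Composition with the reflection `x ↦ -x` on `L²(ℝ)`. -/
def L2.reflect : L2 →ₗᵢ[ℂ] L2 :=
  Lp.compMeasurePreservingₗᵢ ℂ Neg.neg (Measure.measurePreserving_neg volume)

theorem L2.reflect_ae (f : L2) : L2.reflect f =ᵐ[volume] fun x => f (-x) :=
  Lp.coeFn_compMeasurePreserving f (Measure.measurePreserving_neg volume)

theorem L2.integral_mul_reflect (f g : L2) :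
    ∫ x, L2.reflect f x * g x = ∫ x, f x * L2.reflect g x := by
  rw [← integral_neg_eq_self (fun x => f x * L2.reflect g x)]
  refine integral_congr_ae ?_
  have h := (Measure.measurePreserving_neg (volume : Measure ℝ)).quasiMeasurePreserving.ae
    (L2.reflect_ae g)
  filter_upwards [L2.reflect_ae f, h] with x h1 h2
  rw [h1, h2, neg_neg]

theorem H1.hasWeakDeriv_reflect (u : H1) :
    HasWeakDeriv (L2.reflect u.toL2) (-L2.reflect u.weakDeriv) := by
  intro φ hφ hc
  have h : ∀ (ψ : ℝ → ℝ) (f : L2), ∫ x, ψ x • L2.reflect f x = ∫ x, ψ (-x) • f x := fun ψ f => by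
    rw [← integral_neg_eq_self]
    refine integral_congr_ae ?_
    have h := (Measure.measurePreserving_neg (volume : Measure ℝ)).quasiMeasurePreserving.ae
      (L2.reflect_ae f)
    filter_upwards [h] with x h2
    rw [h2, neg_neg]
  have h1 := u.hasWeakDeriv (fun x => φ (-x)) (hφ.comp contDiff_neg)
    (hc.comp_homeomorph (Homeomorph.neg ℝ))
  have h2 : ∫ x, φ x • (-L2.reflect u.weakDeriv : L2) x = -∫ x, φ x • L2.reflect u.weakDeriv x := by
    rw [← integral_neg]
    refine integral_congr_ae ?_
    filter_upwards [Lp.coeFn_neg (L2.reflect u.weakDeriv)] with x hx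
    rw [hx, Pi.neg_apply, smul_neg]
  rw [h2, h, h, ← h1, ← integral_neg]
  exact integral_congr_ae (.of_forall fun x => by simp [deriv_comp_neg])

/-- Composition with the reflection `x ↦ -x` on `H¹(ℝ)`. -/
def H1.reflect : H1 →L[ℂ] H1 :=
  LinearMap.mkContinuous
    { toFun := fun u => H1.mk _ _ u.hasWeakDeriv_reflect
      map_add' := fun u v => H1.ext_toL2 (by simp only [map_add, H1.toL2_mk])
      map_smul' := fun c u => H1.ext_toL2 (by
        simp only [map_smul, H1.toL2_mk, RingHom.id_apply]) } 1 fun u => by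
    rw [one_mul]
    refine (pow_le_pow_iff_left₀ (norm_nonneg _) (norm_nonneg _) two_ne_zero).1 (le_of_eq ?_)
    rw [H1.norm_sq, H1.norm_sq u]
    change ‖L2.reflect u.toL2‖ ^ 2 + ‖-L2.reflect u.weakDeriv‖ ^ 2 = _
    rw [norm_neg, LinearIsometry.norm_map, LinearIsometry.norm_map]

theorem H1.toL2_reflect (u : H1) : (H1.reflect u).toL2 = L2.reflect u.toL2 := rfl

theorem H1.weakDeriv_reflect (u : H1) : (H1.reflect u).weakDeriv = -L2.reflect u.weakDeriv := rfl

theorem H1.rep_reflect (u : H1) (x : ℝ) : (H1.reflect u).rep x = u.rep (-x) := by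
  refine congrFun (H1.rep_eq_of_ae _ (u.continuous_rep.comp continuous_neg) ?_) x
  rw [H1.toL2_reflect]
  have h := (Measure.measurePreserving_neg (volume : Measure ℝ)).quasiMeasurePreserving.ae
    u.rep_ae
  filter_upwards [L2.reflect_ae u.toL2, h] with y h1 h2
  rw [h1, h2]
  rfl

theorem H1.isEven_iff (u : H1) : u.IsEven ↔ H1.reflect u = u := by
  constructor
  · intro h
    refine H1.ext_rep (funext fun x => ?_)
    rw [H1.rep_reflect, h x]
  · intro h x
    rw [← H1.rep_reflect, h]

/-! ### The propagator of `-d²/dx² - Zδ(x)` -/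

/-- Cauchy–Schwarz inequality on `[0, s²]`. -/
theorem L2.integral_norm_le_sqrt_mul (f : L2) {s : ℝ} (hs : 0 < s) :
    ∫ t in (0 : ℝ)..s ^ 2, ‖f t‖ ≤ s * ‖f‖ := by
  have hm := (Lp.memLp f).restrict (Ioc 0 (s ^ 2))
  rw [intervalIntegral.integral_of_le (by positivity), integral_norm_eq_lintegral_enorm hm.1,
    ← eLpNorm_one_eq_lintegral_enorm, Lp.norm_def]
  have h := eLpNorm_le_eLpNorm_mul_rpow_measure_univ (p := 1) (q := 2) one_le_two hm.1
  have e : (volume.restrict (Ioc 0 (s ^ 2))) univ ^ (1 / (1 : ℝ≥0∞).toReal - 1 / (2 : ℝ≥0∞).toReal)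
      = ENNReal.ofReal s := by
    rw [Measure.restrict_apply_univ, Real.volume_Ioc, sub_zero,
      ENNReal.ofReal_rpow_of_pos (by positivity)]
    congr 1
    rw [← Real.rpow_natCast, ← Real.rpow_mul hs.le]
    norm_num
  rw [e] at h
  rw [← ENNReal.toReal_ofReal hs.le, mul_comm, ← ENNReal.toReal_mul]
  refine ENNReal.toReal_mono (ENNReal.mul_ne_top (Lp.memLp f).2.ne ENNReal.ofReal_ne_top) ?_
  rw [ENNReal.toReal_ofReal hs.le]
  exact h.trans (by gcongr; exact Measure.restrict_le_self)

/-- Trace inequality with an arbitrarily small factor in front of the derivative, obtained by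
averaging `u(0) = u(y) - ∫₀ʸ u'` over `y ∈ [0, s²]`. -/
theorem H1.mul_norm_rep_zero_le (u : H1) {s : ℝ} (hs : 0 < s) :
    s * ‖u.rep 0‖ ≤ ‖u.toL2‖ + s ^ 2 * ‖u.weakDeriv‖ := by
  have hgi : ∀ a b, IntervalIntegrable (fun t => ‖u.weakDeriv t‖) volume a b := fun a b =>
    (intervalIntegrable_of_locallyIntegrable u.weakDeriv.locallyIntegrable a b).norm
  have h1 : ∀ y ∈ Icc 0 (s ^ 2), ‖u.rep 0‖ ≤ ‖u.rep y‖ + s * ‖u.weakDeriv‖ := by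
    intro y hy
    have e : u.rep 0 = u.rep y - ∫ t in (0 : ℝ)..y, u.weakDeriv t := by
      rw [← u.rep_sub_rep]; ring
    rw [e]
    refine (norm_sub_le _ _).trans ?_
    gcongr
    calc ‖∫ t in (0 : ℝ)..y, u.weakDeriv t‖ ≤ ∫ t in (0 : ℝ)..y, ‖u.weakDeriv t‖ :=
          intervalIntegral.norm_integral_le_integral_norm hy.1
      _ ≤ ∫ t in (0 : ℝ)..s ^ 2, ‖u.weakDeriv t‖ :=
          intervalIntegral.integral_mono_interval le_rfl hy.1 hy.2
            (.of_forall fun _ => norm_nonneg _) (hgi _ _)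
      _ ≤ _ := L2.integral_norm_le_sqrt_mul _ hs
  have hc : Continuous fun y => ‖u.rep y‖ + s * ‖u.weakDeriv‖ :=
    u.continuous_rep.norm.add continuous_const
  have h2 : ∫ _ in (0 : ℝ)..s ^ 2, ‖u.rep 0‖ ≤
      ∫ y in (0 : ℝ)..s ^ 2, (‖u.rep y‖ + s * ‖u.weakDeriv‖) :=
    intervalIntegral.integral_mono_on (by positivity) (by simp) (hc.intervalIntegrable _ _) h1
  rw [intervalIntegral.integral_add (u.continuous_rep.norm.intervalIntegrable _ _) (by simp)]
    at h2
  have h3 : ∫ y in (0 : ℝ)..s ^ 2, ‖u.rep y‖ = ∫ y in (0 : ℝ)..s ^ 2, ‖u.toL2 y‖ := by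
    refine intervalIntegral.integral_congr_ae ?_
    filter_upwards [u.rep_ae] with y hy _
    rw [hy]
  simp only [intervalIntegral.integral_const, sub_zero, smul_eq_mul] at h2
  have h4 := L2.integral_norm_le_sqrt_mul u.toL2 hs
  refine le_of_mul_le_mul_left ?_ hs
  nlinarith

/-- If `M` is self-adjoint and coercive and `N` is self-adjoint and injective, then `M⁻¹N` is
conjugate to the self-adjoint operator `M^{-1/2} N M^{-1/2}`, and has a propagator. -/
theorem exists_isPropagator_of_coercive {X : Type*} [NormedAddCommGroup X] [InnerProductSpace ℂ X]
    [CompleteSpace X] {M N : X →L[ℂ] X} (hM : IsSelfAdjoint M) {c : ℝ} (hc : 0 < c)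
    (hcoer : ∀ x, c * ‖x‖ ^ 2 ≤ (inner ℂ (M x) x).re) (hN : IsSelfAdjoint N)
    (hNi : Function.Injective N) :
    ∃ (E : X ≃L[ℂ] X) (U : ℝ → X →L[ℂ] X), (∀ x, E x = M x) ∧
      IsPropagator ((E.symm : X →L[ℂ] X).comp N) U := by
  have hM0 : 0 ≤ M := by
    rw [ContinuousLinearMap.nonneg_iff_isPositive]
    refine ⟨hM.isSymmetric, fun x => ?_⟩
    exact (by positivity : 0 ≤ c * ‖x‖ ^ 2).trans (hcoer x)
  have hMu : IsUnit M := by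
    refine ContinuousLinearMap.isUnit_of_forall_le_norm_inner_map M (c := ⟨c, hc.le⟩) hc
      fun x => ?_
    refine le_trans ?_ (Complex.re_le_norm _)
    rw [mul_comm]
    exact hcoer x
  obtain ⟨Q, hQ⟩ := (CFC.isUnit_sqrt_iff M hM0).2 hMu
  have hQs : IsSelfAdjoint (Q : X →L[ℂ] X) := by
    rw [hQ]
    exact (CFC.sqrt_nonneg M).isSelfAdjoint
  have hQQ : (Q : X →L[ℂ] X) * Q = M := by
    rw [hQ]
    exact CFC.sqrt_mul_sqrt_self M hM0
  have hQi : IsSelfAdjoint ((Q⁻¹ : (X →L[ℂ] X)ˣ) : X →L[ℂ] X) := by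
    have h : star Q = Q := Units.ext hQs.star_eq
    rw [IsSelfAdjoint, ← Units.coe_star, star_inv, h]
  let q : X ≃L[ℂ] X := ContinuousLinearEquiv.ofUnit Q
  let K₀ : X →L[ℂ] X := (Q⁻¹ : (X →L[ℂ] X)ˣ) * N * (Q⁻¹ : (X →L[ℂ] X)ˣ)
  have hK₀ : IsSelfAdjoint K₀ := by
    rw [IsSelfAdjoint, star_mul, star_mul, hQi.star_eq, hN.star_eq, ← mul_assoc]
  have hK₀i : Function.Injective K₀ :=
    q.symm.injective.comp (hNi.comp q.symm.injective)
  obtain ⟨U, hU⟩ := exists_isPropagator_of_isSelfAdjoint hK₀ hK₀i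
  refine ⟨q.trans q, fun t => ((q.symm : X →L[ℂ] X).comp (U t)).comp (q : X →L[ℂ] X),
    fun x => ?_, ?_⟩
  · rw [← hQQ]
    rfl
  · have e : (((q.trans q).symm : X →L[ℂ] X).comp N) =
        ((q.symm : X →L[ℂ] X).comp K₀).comp (q : X →L[ℂ] X) := by
      ext x
      change q.symm (q.symm (N x)) = q.symm (q.symm (N (q.symm (q x))))
      rw [q.symm_apply_apply]
    rw [e]
    exact hU.conj q

/-- The linear isometry `H¹(ℝ) ≃ H⁻¹(ℝ)` given by `⟨Θx, v⟩ = ∫ x v + ∫ x' v'`. -/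
def dualEquiv : H1 ≃ₗᵢ[ℂ] Hneg1 := H1.conj.trans (InnerProductSpace.toDual ℂ H1)

theorem dualEquiv_apply (x v : H1) : dualEquiv x v = inner ℂ (H1.conj v) x := by
  change inner ℂ (H1.conj x) v = _
  rw [H1.inner_eq, H1.inner_eq]
  simp only [H1.toL2_conj, H1.weakDeriv_conj, L2.inner_star]
  simp only [mul_comm]

/-- The operator `M` on `H¹(ℝ)` that represents the form
`∫ u' v' + m ∫ u v - Z u(0) v(0)`. -/
def formOperator (Z m : ℝ) : H1 →L[ℂ] H1 :=
  ContinuousLinearMap.adjoint H1.weakDeriv ∘L H1.weakDeriv +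
    ((m : ℂ) • (ContinuousLinearMap.adjoint H1.toL2 ∘L H1.toL2) -
      (Z : ℂ) • (ContinuousLinearMap.adjoint dirac0 ∘L dirac0))

theorem inner_formOperator (Z m : ℝ) (v u : H1) :
    inner ℂ v (formOperator Z m u) = inner ℂ v.weakDeriv u.weakDeriv +
      (m * inner ℂ v.toL2 u.toL2 - Z * inner ℂ (v.rep 0) (u.rep 0)) := by
  simp only [formOperator, add_apply, sub_apply, smul_apply, ContinuousLinearMap.comp_apply,
    inner_add_right, inner_sub_right, inner_smul_right, ContinuousLinearMap.adjoint_inner_right,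
    dirac0_apply]

theorem isSelfAdjoint_adjoint_comp {Y : Type*} [NormedAddCommGroup Y] [InnerProductSpace ℂ Y]
    [CompleteSpace Y] (A : H1 →L[ℂ] Y) :
    IsSelfAdjoint (ContinuousLinearMap.adjoint A ∘L A) := by
  rw [ContinuousLinearMap.isSelfAdjoint_iff', ContinuousLinearMap.adjoint_comp,
    ContinuousLinearMap.adjoint_adjoint]

theorem isSelfAdjoint_formOperator (Z m : ℝ) : IsSelfAdjoint (formOperator Z m) := by
  have hr : ∀ r : ℝ, IsSelfAdjoint (r : ℂ) := fun r => Complex.conj_ofReal r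
  exact (isSelfAdjoint_adjoint_comp _).add
    (((hr m).smul (isSelfAdjoint_adjoint_comp _)).sub
      ((hr Z).smul (isSelfAdjoint_adjoint_comp _)))

/-- The form is coercive when `m` is large: the trace inequality absorbs the point interaction. -/
theorem exists_formOperator_coercive (Z : ℝ) :
    ∃ m : ℝ, ∀ u, 1 / 2 * ‖u‖ ^ 2 ≤ (inner ℂ (formOperator Z m u) u).re := by
  refine ⟨8 * (|Z| + 1) ^ 2 + 1, fun u => ?_⟩
  set m := 8 * (|Z| + 1) ^ 2 + 1
  have hZ := abs_nonneg Z
  -- Here `s ^ 2 = 1 / (4 (|Z| + 1))`.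
  obtain ⟨s, hs, hs2⟩ : ∃ s : ℝ, 0 < s ∧ 4 * (|Z| + 1) * s ^ 2 = 1 := by
    refine ⟨Real.sqrt (1 / (4 * (|Z| + 1))), by positivity, ?_⟩
    rw [Real.sq_sqrt (by positivity)]
    field_simp
  have h1 := u.mul_norm_rep_zero_le hs
  have e : (inner ℂ (formOperator Z m u) u).re =
      ‖u.weakDeriv‖ ^ 2 + (m * ‖u.toL2‖ ^ 2 - Z * ‖u.rep 0‖ ^ 2) := by
    have h : ((inner ℂ u (formOperator Z m u) : ℂ)).re = (inner ℂ (formOperator Z m u) u).re := by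
      simpa using inner_re_symm (𝕜 := ℂ) u (formOperator Z m u)
    rw [← h, inner_formOperator]
    simp only [inner_self_eq_norm_sq_to_K]
    rw [← Complex.ofReal_re (‖u.weakDeriv‖ ^ 2 + (m * ‖u.toL2‖ ^ 2 - Z * ‖u.rep 0‖ ^ 2))]
    push_cast
    rfl
  rw [e, u.norm_sq]
  set a := ‖u.toL2‖
  set b := ‖u.weakDeriv‖
  set r := ‖u.rep 0‖
  have h2 : s ^ 2 * r ^ 2 ≤ 2 * a ^ 2 + 2 * s ^ 4 * b ^ 2 := by
    have : (s * r) ^ 2 ≤ (a + s ^ 2 * b) ^ 2 := by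
      gcongr
    nlinarith [sq_nonneg (a - s ^ 2 * b)]
  have h3 : (|Z| + 1) * r ^ 2 ≤ 8 * (|Z| + 1) ^ 2 * a ^ 2 + 1 / 2 * b ^ 2 := by
    have h4 := mul_le_mul_of_nonneg_left h2 (by positivity : 0 ≤ 4 * (|Z| + 1) ^ 2)
    have e1 : 4 * (|Z| + 1) ^ 2 * (s ^ 2 * r ^ 2) = (|Z| + 1) * r ^ 2 := by
      linear_combination ((|Z| + 1) * r ^ 2) * hs2
    have e2 : 4 * (|Z| + 1) ^ 2 * (2 * a ^ 2 + 2 * s ^ 4 * b ^ 2) =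
        8 * (|Z| + 1) ^ 2 * a ^ 2 + 1 / 2 * b ^ 2 := by
      linear_combination (1 / 2 * b ^ 2 * (4 * (|Z| + 1) * s ^ 2 + 1)) * hs2
    rwa [e1, e2] at h4
  have h5 : Z * r ^ 2 ≤ (|Z| + 1) * r ^ 2 := by
    gcongr
    linarith [le_abs_self Z]
  have h6 : 0 ≤ a ^ 2 := sq_nonneg a
  nlinarith

/-- For large `m`, the operator `J = A_Z + m` is an isomorphism `H¹(ℝ) ≃ H⁻¹(ℝ)`, and
`K = J⁻¹`, restricted to `H¹(ℝ)`, has a propagator. -/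
theorem exists_isPropagator (Z : ℝ) :
    ∃ (m : ℝ) (J : H1 ≃L[ℂ] Hneg1) (K : H1 →L[ℂ] H1) (U : ℝ → H1 →L[ℂ] H1),
      (∀ u, J u = pointInteraction Z u + (m : ℂ) • u.toHneg1) ∧ (∀ u, J (K u) = u.toHneg1) ∧
      Function.Injective K ∧ IsPropagator K U := by
  obtain ⟨m, hm⟩ := exists_formOperator_coercive Z
  have hN : Function.Injective (ContinuousLinearMap.adjoint H1.toL2 ∘L H1.toL2) := by
    rw [injective_iff_map_eq_zero]
    intro u hu
    apply H1.ext_toL2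
    rw [map_zero, ← inner_self_eq_zero (𝕜 := ℂ), ← ContinuousLinearMap.adjoint_inner_right]
    change inner ℂ u ((ContinuousLinearMap.adjoint H1.toL2 ∘L H1.toL2) u) = 0
    rw [hu, inner_zero_right]
  obtain ⟨E, U, hE, hU⟩ := exists_isPropagator_of_coercive (isSelfAdjoint_formOperator Z m)
    (by norm_num) hm (isSelfAdjoint_adjoint_comp H1.toL2) hN
  refine ⟨m, E.trans dualEquiv.toContinuousLinearEquiv, _, U, fun u => ?_, fun u => ?_,
    E.symm.injective.comp hN, hU⟩
  · ext v
    change dualEquiv (E u) v = pointInteraction Z u v + m * L2.toHneg1 u.toL2 v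
    rw [dualEquiv_apply, hE, inner_formOperator, pointInteraction_apply, L2.toHneg1_apply,
      H1.toL2_conj, H1.weakDeriv_conj, L2.inner_star, L2.inner_star, H1.rep_conj,
      RCLike.inner_apply]
    simp only [RCLike.star_def, RCLike.conj_conj, mul_comm (v.weakDeriv _), mul_comm (v.toL2 _)]
    ring
  · ext v
    change dualEquiv (E (E.symm ((ContinuousLinearMap.adjoint H1.toL2 ∘L H1.toL2) u))) v =
      L2.toHneg1 u.toL2 v
    rw [E.apply_symm_apply, dualEquiv_apply, ContinuousLinearMap.comp_apply,
      ContinuousLinearMap.adjoint_inner_right, H1.toL2_conj, L2.inner_star, L2.toHneg1_apply]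
    simp only [mul_comm]

/-! ### The nonlinearity on `H¹(ℝ)` -/

/-- The nonlinearity `m u + λ₁|u|²u + λ₂|u|⁴u` as a map from `H¹(ℝ)` to itself. -/
def shiftedNonlinearity (m l₁ l₂ : ℝ) (u : H1) : H1 :=
  m • u + (l₁ • H1.mul (H1.mul u (H1.conjL u)) u +
    l₂ • H1.mul (H1.mul (H1.mul u (H1.conjL u)) (H1.mul u (H1.conjL u))) u)

theorem toHneg1_shiftedNonlinearity (m l₁ l₂ : ℝ) (u : H1) :
    (shiftedNonlinearity m l₁ l₂ u).toHneg1 =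
      (m : ℂ) • u.toHneg1 + (nonlinearity l₁ l₂ u).toHneg1 := by
  have h : (l₁ • H1.mul (H1.mul u (H1.conjL u)) u +
      l₂ • H1.mul (H1.mul (H1.mul u (H1.conjL u)) (H1.mul u (H1.conjL u))) u).toL2 =
      nonlinearity l₁ l₂ u := by
    set w := l₁ • H1.mul (H1.mul u (H1.conjL u)) u +
      l₂ • H1.mul (H1.mul (H1.mul u (H1.conjL u)) (H1.mul u (H1.conjL u))) u with hw
    refine Lp.ext ?_
    filter_upwards [w.rep_ae, (u.memLp_nonlinearity l₁ l₂).coeFn_toLp, u.rep_ae] with x h1 h2 h3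
    rw [h1, nonlinearity, h2, h3, hw]
    have hr : ∀ (r : ℝ) (v : H1), (r • v).rep x = r * v.rep x := fun r v =>
      H1.rep_smul (r : ℂ) v x
    have hn : u.rep x * star (u.rep x) = ((‖u.rep x‖ ^ 2 : ℝ) : ℂ) := by
      rw [Complex.star_def, Complex.mul_conj']
      push_cast
      rfl
    simp only [H1.rep_add, hr, H1.rep_mul, H1.conjL_apply, H1.rep_conj, hn]
    push_cast
    ring
  have hm : (m • u).toHneg1 = (m : ℂ) • u.toHneg1 := H1.toHneg1.map_smul (m : ℂ) u
  rw [shiftedNonlinearity, map_add, hm, ← h]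
  rfl

theorem hasSmoothSuperposition_shiftedNonlinearity {ι : Type*} [TopologicalSpace ι]
    [CompactSpace ι] (m l₁ l₂ : ℝ) :
    HasSmoothSuperposition fun _ : ι => shiftedNonlinearity m l₁ l₂ := by
  have hid : HasSmoothSuperposition fun (_ : ι) (u : H1) => u :=
    hasSmoothSuperposition_clm (ContinuousLinearMap.id ℝ H1)
  have hs := fun r : ℝ => hasSmoothSuperposition_clm (ι := ι) (r • ContinuousLinearMap.id ℝ H1)
  let B : H1 →L[ℝ] H1 →L[ℝ] H1 := H1.mul.bilinearRestrictScalars ℝ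
  have h2 := hid.bilin B (hasSmoothSuperposition_clm H1.conjL)
  exact ((hs m).comp hid).add (((hs l₁).comp (h2.bilin B hid)).add
    ((hs l₂).comp ((h2.bilin B h2).bilin B hid)))

theorem boundedLipschitzOnBalls_shiftedNonlinearity {ι : Type*} (m l₁ l₂ : ℝ) :
    BoundedLipschitzOnBalls fun _ : ι => shiftedNonlinearity m l₁ l₂ := by
  have hid : BoundedLipschitzOnBalls fun (_ : ι) (u : H1) => u :=
    boundedLipschitzOnBalls_clm (ContinuousLinearMap.id ℝ H1)
  have hs := fun r : ℝ => boundedLipschitzOnBalls_clm (ι := ι) (r • ContinuousLinearMap.id ℝ H1)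
  let B : H1 →L[ℝ] H1 →L[ℝ] H1 := H1.mul.bilinearRestrictScalars ℝ
  have h2 := hid.bilin B (boundedLipschitzOnBalls_clm H1.conjL)
  exact ((hs m).comp hid).add (((hs l₁).comp (h2.bilin B hid)).add
    ((hs l₂).comp ((h2.bilin B h2).bilin B hid)))

theorem continuous_shiftedNonlinearity (m l₁ l₂ : ℝ) :
    Continuous (shiftedNonlinearity m l₁ l₂) := by
  have hm : ∀ {f g : H1 → H1}, Continuous f → Continuous g →
      Continuous fun u => H1.mul (f u) (g u) := fun hf hg => (H1.mul.continuous.comp hf).clm_apply hg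
  have h2 := hm continuous_id H1.conjL.continuous
  exact (continuous_id.const_smul m).add (((hm h2 continuous_id).const_smul l₁).add
    ((hm (hm h2 h2) continuous_id).const_smul l₂))

/-! ### The interaction picture -/

section Interaction

variable {X : Type*} [NormedAddCommGroup X] [NormedSpace ℂ X] {K : X →L[ℂ] X}
  {U : ℝ → X →L[ℂ] X}

/-- The passage `u ↦ (t ↦ U(-t)u(t))` to the interaction picture. -/
def IsPropagator.pull (h : IsPropagator K U) {T : ℝ} (u : C(Icc (-T) T, X)) : C(Icc (-T) T, X) :=
  ⟨fun t => U (-t) (u t), h.continuous_uncurry.comp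
    (continuous_subtype_val.neg.prodMk u.continuous)⟩

theorem IsPropagator.boundedLipschitzOnBalls_interaction (h : IsPropagator K U) {F : X → X}
    (hF : BoundedLipschitzOnBalls fun _ : ℝ => F) : BoundedLipschitzOnBalls (interaction U F) := by
  obtain ⟨C, hC⟩ := h.bounded
  have h1 := boundedLipschitzOnBalls_family (A := fun t => (U t).restrictScalars ℝ) (C := C)
    fun t => by rw [ContinuousLinearMap.norm_restrictScalars]; exact hC t
  have h2 := boundedLipschitzOnBalls_family
    (A := fun t => (Complex.I • U (-t)).restrictScalars ℝ) (C := C) fun t => by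
      rw [ContinuousLinearMap.norm_restrictScalars, norm_smul, Complex.norm_I, one_mul]
      exact hC _
  exact h2.comp (hF.comp h1)

theorem IsPropagator.hasSmoothSuperposition (h : IsPropagator K U) (T : ℝ) :
    HasSmoothSuperposition fun (t : Icc (-T) T) x => U t x := by
  obtain ⟨C, hC⟩ := h.bounded
  exact hasSmoothSuperposition_family (A := fun t : Icc (-T) T => (U t).restrictScalars ℝ) (C := C)
    (fun t => by rw [ContinuousLinearMap.norm_restrictScalars]; exact hC t)
    (h.continuous_uncurry.comp ((continuous_subtype_val.comp continuous_fst).prodMk continuous_snd))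

theorem IsPropagator.hasSmoothSuperposition_interaction (h : IsPropagator K U) {F : X → X} {T : ℝ}
    (hF : HasSmoothSuperposition fun _ : Icc (-T) T => F) :
    HasSmoothSuperposition fun t : Icc (-T) T => interaction U F t := by
  obtain ⟨C, hC⟩ := h.bounded
  have h2 := hasSmoothSuperposition_family
    (A := fun t : Icc (-T) T => (Complex.I • U (-t)).restrictScalars ℝ) (C := C) (fun t => by
      rw [ContinuousLinearMap.norm_restrictScalars, norm_smul, Complex.norm_I, one_mul]
      exact hC _)
    ((h.continuous_uncurry.comp ((continuous_subtype_val.comp continuous_fst).neg.prodMk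
      continuous_snd)).const_smul Complex.I)
  exact h2.comp (hF.comp (h.hasSmoothSuperposition T))

end Interaction

/-- A function solves the Schrödinger equation if and only if it solves the integral equation in
the interaction picture. -/
theorem isSolution_iff {Z m l₁ l₂ : ℝ} {J : H1 ≃L[ℂ] Hneg1} {K : H1 →L[ℂ] H1}
    {U : ℝ → H1 →L[ℂ] H1} (hJ : ∀ u, J u = pointInteraction Z u + (m : ℂ) • u.toHneg1)
    (hJK : ∀ u, J (K u) = u.toHneg1) (hK : Function.Injective K) (hU : IsPropagator K U)
    {T : ℝ} (hT : 0 < T) (u₀ : H1) (u : C(Icc (-T) T, H1)) :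
    IsSolution Z l₁ l₂ hT u₀ u ↔
      IsIntegralSolution (interaction U (shiftedNonlinearity m l₁ l₂)) hT u₀ (hU.pull u) := by
  set F := shiftedNonlinearity m l₁ l₂ with hFdef
  have hF : Continuous F := continuous_shiftedNonlinearity m l₁ l₂
  have h0 : (0 : ℝ) ∈ Icc (-T) T := ⟨by linarith, hT.le⟩
  let ue : ℝ → H1 := IccExtend (neg_le_self hT.le) u
  have hue : ∀ t (ht : t ∈ Icc (-T) T), ue t = u ⟨t, ht⟩ := fun t ht => IccExtend_of_mem _ _ ht
  have hue' : ∀ t : Icc (-T) T, ue t = u t := fun t => hue t t.2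
  -- `A_Z + m = J` and `JK` is the inclusion, so `J` maps the abstract equation to the original one.
  have hJF : ∀ v : H1, J (v - K (F v)) =
      pointInteraction Z v - (nonlinearity l₁ l₂ v).toHneg1 := fun v => by
    rw [map_sub, hJ, hJK, toHneg1_shiftedNonlinearity]
    abel
  have hcomp : (fun s => (ue s).toHneg1) = fun s => J (K (ue s)) := by
    funext s
    rw [hJK]
  have hsol : IsSolution Z l₁ l₂ hT u₀ u ↔ ue 0 = u₀ ∧ ∀ t ∈ Icc (-T) T,
      HasDerivWithinAt (fun t => K (ue t)) (-Complex.I • (ue t - K (F (ue t)))) (Icc (-T) T) t := by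
    refine and_congr (by rw [hue 0 h0]) ⟨?_, fun hd => ?_⟩
    · rintro ⟨w, hw⟩ t ht
      obtain ⟨h1, h2⟩ := hw ⟨t, ht⟩
      have h3 : w ⟨t, ht⟩ = J (-Complex.I • (ue t - K (F (ue t)))) := by
        rw [map_smul, hJF, hue t ht]
        have h4 : Complex.I • w ⟨t, ht⟩ =
            pointInteraction Z (u ⟨t, ht⟩) - (nonlinearity l₁ l₂ (u ⟨t, ht⟩)).toHneg1 := by
          rw [← sub_eq_zero, ← h2]
          abel
        rw [← h4, smul_smul, neg_mul, Complex.I_mul_I, neg_neg, one_smul]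
      have h5 : HasDerivWithinAt (fun s => J (K (ue s)))
          (J (-Complex.I • (ue t - K (F (ue t))))) (Icc (-T) T) t := by
        rw [← h3, ← hcomp]
        exact h1
      have h6 :=
        ((J.symm : Hneg1 →L[ℂ] H1).restrictScalars ℝ).hasFDerivAt.comp_hasDerivWithinAt t h5
      simpa [Function.comp_def] using h6
    · refine ⟨⟨fun t => J (-Complex.I • (u t - K (F (u t)))), ?_⟩, fun t => ⟨?_, ?_⟩⟩
      · have h1 : Continuous fun t => u t - K (F (u t)) :=
          u.continuous.sub (K.continuous.comp (hF.comp u.continuous))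
        exact J.continuous.comp (h1.const_smul (-Complex.I))
      · have h5 := ((J : H1 →L[ℂ] Hneg1).restrictScalars ℝ).hasFDerivAt.comp_hasDerivWithinAt
          (t : ℝ) (hd t t.2)
        rw [hue' t] at h5
        change HasDerivWithinAt (fun s => (ue s).toHneg1) _ _ _
        rw [hcomp]
        exact h5
      · change Complex.I • J (-Complex.I • (u t - K (F (u t)))) - _ + _ = 0
        rw [map_smul, hJF, smul_smul, mul_neg, Complex.I_mul_I, neg_neg, one_smul]
        abel
  have hint : IsIntegralSolution (interaction U F) hT u₀ (hU.pull u) ↔ ∀ t ∈ Icc (-T) T,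
      U (-t) (ue t) = u₀ + ∫ s in (0 : ℝ)..t, interaction U F s (U (-s) (ue s)) := by
    have hI : ∀ t ∈ Icc (-T) T,
        ∫ s in (0 : ℝ)..t, interaction U F s (IccExtend (neg_le_self hT.le) (hU.pull u) s) =
        ∫ s in (0 : ℝ)..t, interaction U F s (U (-s) (ue s)) := fun t ht => by
      refine intervalIntegral.integral_congr fun s hs => ?_
      have hs' : s ∈ Icc (-T) T := uIcc_subset_Icc h0 ht hs
      rw [IccExtend_of_mem _ _ hs', hue s hs']
      rfl
    constructor
    · intro h t ht
      rw [← hI t ht, hue t ht]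
      exact h ⟨t, ht⟩
    · intro h t
      rw [hI t t.2, ← h t t.2, hue' t]
      rfl
  have huc : ContinuousOn ue (Icc (-T) T) := u.continuous.Icc_extend'.continuousOn
  rw [hsol, hint, hU.duhamel_iff hK hF hT huc]
  constructor
  · rintro ⟨rfl, h⟩
    exact h
  · intro h
    have h1 : ue 0 = u₀ := by
      have := h 0 h0
      rwa [neg_zero, hU.zero_apply, intervalIntegral.integral_same, add_zero] at this
    exact ⟨h1, h1 ▸ h⟩

/-! ### Reflection of solutions -/

theorem H1.toHneg1_reflect_apply (u v : H1) :
    (H1.reflect u).toHneg1 v = u.toHneg1 (H1.reflect v) := by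
  change L2.toHneg1 _ _ = L2.toHneg1 _ _
  rw [L2.toHneg1_apply, L2.toHneg1_apply]
  exact L2.integral_mul_reflect _ _

theorem pointInteraction_reflect_apply (Z : ℝ) (u v : H1) :
    pointInteraction Z (H1.reflect u) v = pointInteraction Z u (H1.reflect v) := by
  rw [pointInteraction_apply, pointInteraction_apply, H1.rep_reflect, H1.rep_reflect, neg_zero]
  congr 1
  have h : ∀ f g : L2, ∫ x, (-f : L2) x * g x = -∫ x, f x * g x := fun f g => by
    rw [← pairing_apply, ← pairing_apply, map_neg, neg_apply]
  have h' : ∀ f g : L2, ∫ x, f x * (-g : L2) x = -∫ x, f x * g x := fun f g => by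
    rw [← pairing_apply, ← pairing_apply, map_neg]
  rw [H1.weakDeriv_reflect, H1.weakDeriv_reflect, h, h', L2.integral_mul_reflect]

theorem nonlinearity_reflect (l₁ l₂ : ℝ) (u : H1) :
    nonlinearity l₁ l₂ (H1.reflect u) = L2.reflect (nonlinearity l₁ l₂ u) := by
  refine Lp.ext ?_
  have hn := (Measure.measurePreserving_neg (volume : Measure ℝ)).quasiMeasurePreserving.ae
    (u.memLp_nonlinearity l₁ l₂).coeFn_toLp
  filter_upwards [((H1.reflect u).memLp_nonlinearity l₁ l₂).coeFn_toLp,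
    L2.reflect_ae (nonlinearity l₁ l₂ u), L2.reflect_ae u.toL2, hn] with x h1 h2 h3 h4
  rw [nonlinearity, h1, h2, nonlinearity, h4, H1.toL2_reflect, h3]

/-- The reflection of a solution is a solution. -/
theorem IsSolution.reflect {Z l₁ l₂ T : ℝ} {hT : 0 < T} {u₀ : H1} {u : C(Icc (-T) T, H1)}
    (h : IsSolution Z l₁ l₂ hT u₀ u) :
    IsSolution Z l₁ l₂ hT (H1.reflect u₀)
      ((⟨H1.reflect, H1.reflect.continuous⟩ : C(H1, H1)).comp u) := by
  obtain ⟨h0, w, hw⟩ := h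
  let R : Hneg1 →L[ℂ] Hneg1 := (ContinuousLinearMap.compL ℂ H1 H1 ℂ).flip H1.reflect
  have hR : ∀ (φ : Hneg1) (v : H1), R φ v = φ (H1.reflect v) := fun _ _ => rfl
  have hR1 : ∀ v : H1, (H1.reflect v).toHneg1 = R v.toHneg1 := fun v => by
    ext z
    rw [hR, H1.toHneg1_reflect_apply]
  refine ⟨congrArg H1.reflect h0, ⟨fun t => R (w t), R.continuous.comp w.continuous⟩,
    fun t => ⟨?_, ?_⟩⟩
  · have h1 := (R.restrictScalars ℝ).hasFDerivAt.comp_hasDerivWithinAt (t : ℝ) (hw t).1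
    refine h1.congr_deriv rfl |>.congr (fun s hs => ?_) ?_
    · exact hR1 _
    · exact hR1 _
  · have h2 := congrArg R (hw t).2
    rw [map_zero, map_add, map_sub, map_smul] at h2
    change Complex.I • R (w t) - pointInteraction Z (H1.reflect (u t)) +
      (nonlinearity l₁ l₂ (H1.reflect (u t))).toHneg1 = 0
    have h3 : pointInteraction Z (H1.reflect (u t)) = R (pointInteraction Z (u t)) := by
      ext z
      rw [pointInteraction_reflect_apply, hR]
    have h4 : (nonlinearity l₁ l₂ (H1.reflect (u t))).toHneg1 =
        R (nonlinearity l₁ l₂ (u t)).toHneg1 := by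
      ext z
      rw [hR, nonlinearity_reflect, L2.toHneg1_apply, L2.toHneg1_apply]
      exact L2.integral_mul_reflect _ _
    rw [h3, h4, h2]

end

end NLSDelta

theorem theorem2p1 (Z l₁ l₂ : ℝ) :
    -- local existence and uniqueness
    (∀ u₀ : NLSDelta.H1, ∃ (T : ℝ) (hT : 0 < T),
      ∃! u : C(Icc (-T) T, NLSDelta.H1), NLSDelta.IsSolution Z l₁ l₂ hT u₀ u) ∧
    ∀ (T : ℝ) (hT : 0 < T),
      -- uniqueness on every time interval
      (∀ (u₀ : NLSDelta.H1) (u v : C(Icc (-T) T, NLSDelta.H1)),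
        NLSDelta.IsSolution Z l₁ l₂ hT u₀ u → NLSDelta.IsSolution Z l₁ l₂ hT u₀ v → u = v) ∧
      -- the data-to-solution map is smooth on its domain, which is open
      IsOpen (NLSDelta.solvableData Z l₁ l₂ hT) ∧
      (∃ S : NLSDelta.H1 → C(Icc (-T) T, NLSDelta.H1),
        (∀ u₀ ∈ NLSDelta.solvableData Z l₁ l₂ hT, NLSDelta.IsSolution Z l₁ l₂ hT u₀ (S u₀)) ∧
        ContDiffOn ℝ ∞ S (NLSDelta.solvableData Z l₁ l₂ hT)) ∧
      -- even data give even solutions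
      (∀ (u₀ : NLSDelta.H1) (u : C(Icc (-T) T, NLSDelta.H1)),
        NLSDelta.IsSolution Z l₁ l₂ hT u₀ u → u₀.IsEven → ∀ t, (u t).IsEven) := by
  obtain ⟨m, J, K, U, hJ, hJK, hK, hU⟩ := NLSDelta.exists_isPropagator Z
  have hf := hU.continuous_interaction (NLSDelta.continuous_shiftedNonlinearity m l₁ l₂)
  have hl := (hU.boundedLipschitzOnBalls_interaction
    (NLSDelta.boundedLipschitzOnBalls_shiftedNonlinearity m l₁ l₂)).lipschitzOnBalls
  have hiff := fun {T : ℝ} (hT : 0 < T) =>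
    NLSDelta.isSolution_iff (l₁ := l₁) (l₂ := l₂) hJ hJK hK hU hT
  have huniq : ∀ (T : ℝ) (hT : 0 < T) (u₀ : NLSDelta.H1) (u v : C(Icc (-T) T, NLSDelta.H1)),
      NLSDelta.IsSolution Z l₁ l₂ hT u₀ u → NLSDelta.IsSolution Z l₁ l₂ hT u₀ v → u = v := by
    intro T hT u₀ u v hu hv
    have h := ((hiff hT u₀ u).1 hu).unique hT hf hl ((hiff hT u₀ v).1 hv)
    ext1 t
    have ht : U (-t) (u t) = U (-t) (v t) := DFunLike.congr_fun h t
    rw [← hU.apply_neg_apply t (u t), ht, hU.apply_neg_apply]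
  -- The inverse of the passage to the interaction picture.
  have hpush : ∀ T : ℝ, ∃ P : C(Icc (-T) T, NLSDelta.H1) → C(Icc (-T) T, NLSDelta.H1),
      ContDiff ℝ ∞ P ∧ ∀ v, hU.pull (P v) = v := by
    intro T
    obtain ⟨P, hP, hPU⟩ := hU.hasSmoothSuperposition T
    refine ⟨P, hP, fun v => ContinuousMap.ext fun t => ?_⟩
    change U (-t) (P v t) = v t
    rw [hPU, hU.neg_apply_apply]
  refine ⟨fun u₀ => ?_, fun T hT => ?_⟩
  · obtain ⟨T, hT, v, hv⟩ := NLSDelta.exists_isIntegralSolution hf hl u₀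
    obtain ⟨P, -, hP⟩ := hpush T
    have hu : NLSDelta.IsSolution Z l₁ l₂ hT u₀ (P v) := by
      rw [hiff hT, hP]
      exact hv
    exact ⟨T, hT, P v, hu, fun w hw => huniq T hT u₀ w (P v) hw hu⟩
  obtain ⟨P, hPs, hP⟩ := hpush T
  obtain ⟨N, hNs, hN⟩ := hU.hasSmoothSuperposition_interaction
    (NLSDelta.hasSmoothSuperposition_shiftedNonlinearity (ι := Icc (-T) T) m l₁ l₂)
  have hloc : ∀ u₀ ∈ NLSDelta.solvableData Z l₁ l₂ hT,
      ∃ ψ : NLSDelta.H1 → C(Icc (-T) T, NLSDelta.H1), ContDiffAt ℝ ∞ ψ u₀ ∧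
        ∀ᶠ x in nhds u₀, NLSDelta.IsSolution Z l₁ l₂ hT x (ψ x) := by
    rintro u₀ ⟨u, hu⟩
    obtain ⟨ψ, hψ, hs⟩ := ((hiff hT u₀ u).1 hu).exists_contDiffAt hT hl hN hNs
    refine ⟨fun x => P (ψ x), hPs.contDiffAt.comp u₀ hψ, ?_⟩
    filter_upwards [hs] with x hx
    rw [hiff hT, hP]
    exact hx
  refine ⟨huniq T hT, ?_, ?_, ?_⟩
  · rw [isOpen_iff_mem_nhds]
    intro u₀ h₀
    obtain ⟨ψ, -, hs⟩ := hloc u₀ h₀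
    filter_upwards [hs] with x hx
    exact ⟨ψ x, hx⟩
  · classical
    let S : NLSDelta.H1 → C(Icc (-T) T, NLSDelta.H1) := fun x =>
      if h : x ∈ NLSDelta.solvableData Z l₁ l₂ hT then h.choose else 0
    have hS : ∀ x ∈ NLSDelta.solvableData Z l₁ l₂ hT, NLSDelta.IsSolution Z l₁ l₂ hT x (S x) :=
      fun x hx => by
        simp only [S, dif_pos hx]
        exact hx.choose_spec
    refine ⟨S, hS, fun u₀ h₀ => ?_⟩
    obtain ⟨ψ, hψ, hs⟩ := hloc u₀ h₀
    refine (hψ.congr_of_eventuallyEq ?_).contDiffWithinAt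
    filter_upwards [hs] with x hx
    exact huniq T hT x _ _ (hS x ⟨_, hx⟩) hx
  · intro u₀ u hu heven t
    have hr := hu.reflect
    rw [(NLSDelta.H1.isEven_iff u₀).1 heven] at hr
    exact (NLSDelta.H1.isEven_iff _).2 (DFunLike.congr_fun (huniq T hT u₀ _ _ hr hu) t)
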